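/- **Setting.** Fix finite sets: $\mathcal C$ of channels with a distinguished channel $u$, $\mathcal D$ of data symbols containing three distinct symbols $1,\llbracket,\rrbracket$, and $\mathcal A'$ of further actions. Let $\mathcal D_\Box=\mathcal D\cup\{\Box\}$, where $\Box\notin\mathcal D$ is the blank; the action symbols are $c!d$, $c?d$ ($c\in\mathcal C$, $d\in\mathcal D_\Box$) and the elements of $\mathcal A'$ (all distinct), and $\mathcal A_\tau$ is the set of action symbols together with the unobservable action $\tau$. A *transition system* consists of a set of states, a transition relation $s\xrightarrow{a}t$ with labels $a\in\mathcal A_\tau$, an initial state and a set of final states. It has branching degree bounded by $B$ if every state $s$ has at most $B$ outgoing transitions, i.e. pairs $(a,t)$ with $s\xrightarrow{a}t$. A *reactive Turing machine* (RTM) consists of a finite set $S$ of states, a relation $\to\;\subseteq S\times\mathcal D_\Box\times\mathcal A_\tau\times\mathcal D_\Box\times\{L,R\}\times S$, an initial state and a set of final states. Its transition system $\mathcal T(M)$ has as states the configurations (a state and a two-way infinite tape with a head position and finitely many non-blank cells); $(s,d,a,e,m,t)\in\;\to$ yields an $a$-labelled transition from each configuration in state $s$ whose head reads $d$ to the configuration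 in state $t$ obtained by writing $e$ over $d$ and moving the head in direction $m$. The initial configuration is the initial state with the blank tape; a configuration is final iff its state is. The *parallel composition* $[T_1\parallel T_2]_{\{u\}}$ has as states the pairs of states, as initial state the pair of initial states, and as final states the pairs of final states. Its transitions are the transitions of one component, with the other idle, whose label is not of the form $u!d$ or $u?d$, and $\tau$-transitions in which one component performs $u!d$ and the other $u?d$, for the same $d\in\mathcal D_\Box$. Write $\twoheadrightarrow$ and $\to^+$ for the reflexive-transitive and the transitive closure of $\xrightarrow{\tau}$, and $s\xrightarrow{(a)}t$ for "$s\xrightarrow{a}t$, or $a=\tau$ and $s=t$". Transition systems $T_1,T_2$ are *divergence-preserving branching bisimilar*, $T_1\leftrightarrow_b^\Delta T_2$, if there is a relation $\mathcal R$ between their states that relates the initial states, such that $s_1\mathrel{\mathcal R}s_2$ implies the following and the symmetric conditions with the roles of $T_1$ and $T_2$ exchanged: 1. if $s_1\xrightarrow{a}s_1'$, there are $s_2'',s_2'$ with $s_2\twoheadrightarrow s_2''\xrightarrow{(a)}s_2'$, $s_1\mathrel{\mathcal R}s_2''$ and $s_1'\mathrel{\mathcal R}s_2'$; 2. if $s_1$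 is final, there is a final $s_2'$ with $s_2\twoheadrightarrow s_2'$ and $s_1\mathrel{\mathcal R}s_2'$; 3. if $s_1=s_{1,0}\xrightarrow{\tau}s_{1,1}\xrightarrow{\tau}\cdots$ is infinite with $s_{1,i}\mathrel{\mathcal R}s_2$ for all $i$, there is $s_2'$ with $s_2\to^+s_2'$ and $s_{1,i}\mathrel{\mathcal R}s_2'$ for some $i$. Fix injective codings of $\mathcal A_\tau$ and of $\mathcal D_\Box$ as natural numbers, and let $0,1$ code $L,R$. A *Gödel number* of an RTM $M$ is the code, under a standard effective coding of tuples and finite lists of natural numbers, of the number $n$ of states, the initial state, a list of the final states and a list of the transitions of $M$, for some enumeration of the states of $M$ as $0,\dots,n-1$. For a natural number $g$, let $\mathrm{Send}_g$ be the deterministic RTM that outputs the sequence $\llbracket\,1^{g+1}\,\rrbracket$ along channel $u$, symbol by symbol, has no other behaviour, and then halts in its unique final state. **Theorem.** For every natural number $B$ there is an RTM $U_B$ that is universal up to $B$ in the following sense: for every RTM $M$ that has no transition labelled $u!d$ or $u?d$ with $d\in\mathcal D_\Box$ (the channel $u$ being dedicated to the transmission of Gödel numbers) and whose transition system $\mathcal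 T(M)$ has branching degree bounded by $B$, and for every Gödel number $g$ of $M$, $$\mathcal T(M)\;\leftrightarrow_b^\Delta\;[\,\mathcal T(U_B)\parallel\mathcal T(\mathrm{Send}_g)\,]_{\{u\}}.$$ -/

import Mathlib

namespace ReactiveTM

/-- Action symbols: for every channel `c` and tape symbol `d` (where `none : Option D` is the blank)
the actions `c!d` (send) and `c?d` (receive), and further, uninterpreted actions `A`. -/
inductive Action (Chan D A : Type*) where
  | send (c : Chan) (d : Option D)
  | recv (c : Chan) (d : Option D)
  | other (a : A)

/-! ### Labelled transition systems; the label `none` is the unobservable action `τ` -/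

structure LTS.{w, a} (Act : Type a) where
  State : Type w
  step : State → Option Act → State → Prop
  init : State
  final : Set State

namespace LTS

variable {Act : Type*}

/-- The set of outgoing transitions of a state. -/
def out (T : LTS Act) (s : T.State) : Set (Option Act × T.State) :=
  {p | T.step s p.1 p.2}

/-- Every state has at most `B` outgoing transitions. -/
def BranchingBoundedBy (T : LTS Act) (B : ℕ) : Prop :=
  ∀ s, (T.out s).encard ≤ B

def tauStep (T : LTS Act) (s t : T.State) : Prop := T.step s none t

/-- Zero or more `τ`-steps. -/
def tauStar (T : LTS Act) : T.State → T.State → Prop := Relation.ReflTransGen T.tauStep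

/-- One or more `τ`-steps. -/
def tauPlus (T : LTS Act) : T.State → T.State → Prop := Relation.TransGen T.tauStep

/-- An `a`-step, or possibly no step at all if `a = τ`. -/
def optStep (T : LTS Act) (s : T.State) (a : Option Act) (t : T.State) : Prop :=
  T.step s a t ∨ (a = none ∧ s = t)

structure IsBranchingBisimulation (T₁ T₂ : LTS Act) (R : T₁.State → T₂.State → Prop) : Prop where
  step_left : ∀ s₁ s₂, R s₁ s₂ → ∀ a s₁', T₁.step s₁ a s₁' →
    ∃ s₂'' s₂', T₂.tauStar s₂ s₂'' ∧ T₂.optStep s₂'' a s₂' ∧ R s₁ s₂'' ∧ R s₁' s₂'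
  step_right : ∀ s₁ s₂, R s₁ s₂ → ∀ a s₂', T₂.step s₂ a s₂' →
    ∃ s₁'' s₁', T₁.tauStar s₁ s₁'' ∧ T₁.optStep s₁'' a s₁' ∧ R s₁'' s₂ ∧ R s₁' s₂'
  final_left : ∀ s₁ s₂, R s₁ s₂ → s₁ ∈ T₁.final →
    ∃ s₂', T₂.tauStar s₂ s₂' ∧ R s₁ s₂' ∧ s₂' ∈ T₂.final
  final_right : ∀ s₁ s₂, R s₁ s₂ → s₂ ∈ T₂.final →
    ∃ s₁', T₁.tauStar s₁ s₁' ∧ R s₁' s₂ ∧ s₁' ∈ T₁.final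

structure IsDivergencePreserving (T₁ T₂ : LTS Act) (R : T₁.State → T₂.State → Prop) : Prop where
  div_left : ∀ s₁ s₂, R s₁ s₂ → ∀ f : ℕ → T₁.State, f 0 = s₁ →
    (∀ i, T₁.tauStep (f i) (f (i + 1)) ∧ R (f i) s₂) →
    ∃ s₂', T₂.tauPlus s₂ s₂' ∧ ∃ i, R (f i) s₂'
  div_right : ∀ s₁ s₂, R s₁ s₂ → ∀ f : ℕ → T₂.State, f 0 = s₂ →
    (∀ i, T₂.tauStep (f i) (f (i + 1)) ∧ R s₁ (f i)) →
    ∃ s₁', T₁.tauPlus s₁ s₁' ∧ ∃ i, R s₁' (f i)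

/-- Divergence-preserving branching bisimilarity. -/
def DivBranchingBisimilar (T₁ T₂ : LTS Act) : Prop :=
  ∃ R : T₁.State → T₂.State → Prop,
    IsBranchingBisimulation T₁ T₂ R ∧ IsDivergencePreserving T₁ T₂ R ∧ R T₁.init T₂.init

/-- The parallel composition `[T₁ ∥ T₂]_C`: interleaving of the actions that are not communications
along a channel of `C`, and synchronisation, resulting in `τ`, of `c!d` with `c?d` for `c ∈ C`. -/
def par {Chan D A : Type*} (C : Set Chan) (T₁ T₂ : LTS (Action Chan D A)) :
    LTS (Action Chan D A) where
  State := T₁.State × T₂.State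
  step p a q :=
    (¬ ∃ c ∈ C, ∃ d, a = some (.send c d) ∨ a = some (.recv c d)) ∧
    ((T₁.step p.1 a q.1 ∧ p.2 = q.2) ∨ (T₂.step p.2 a q.2 ∧ p.1 = q.1) ∨
      (a = none ∧ ∃ c ∈ C, ∃ d,
        (T₁.step p.1 (some (.send c d)) q.1 ∧ T₂.step p.2 (some (.recv c d)) q.2) ∨
        (T₁.step p.1 (some (.recv c d)) q.1 ∧ T₂.step p.2 (some (.send c d)) q.2)))
  init := (T₁.init, T₂.init)
  final := {p | p.1 ∈ T₁.final ∧ p.2 ∈ T₂.final}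

end LTS

/-! ### Reactive Turing machines -/

/-- A reactive Turing machine with action symbols `Act` and data symbols `D`.
`trans s d a e m t` means: in state `s`, reading `d`, the machine may execute the action `a`
(`none` is `τ`), replace `d` by `e`, move the head in direction `m`, and enter state `t`. -/
structure RTM.{w, a, d} (Act : Type a) (D : Type d) where
  State : Type w
  finite_state : Finite State
  trans : State → Option D → Option Act → Option D → Turing.Dir → State → Prop
  init : State
  final : Set State

namespace RTM

/-- The transition system associated with `M`. Configurations are pairs of a state and a two-way
infinite tape with a head position and finitely many non-blank cells; initially the tape is blank.
(Tape instances equal up to blanks at both ends are identified in Mathlib's `Turing.Tape`.) -/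
def lts {Act D : Type*} (M : RTM Act D) : LTS Act where
  State := M.State × Turing.Tape (Option D)
  step c a c' := ∃ e m, M.trans c.1 c.2.head a e m c'.1 ∧ c'.2 = (c.2.write e).move m
  init := (M.init, Turing.Tape.mk₁ [])
  final := {c | c.1 ∈ M.final}

/-- No transition of `M` is labelled with a communication along the channel `u`. -/
def AvoidsChannel {Chan D A : Type*} (M : RTM (Action Chan D A) D) (u : Chan) : Prop :=
  ∀ s d e m t x,
    ¬ M.trans s d (some (.send u x)) e m t ∧ ¬ M.trans s d (some (.recv u x)) e m t

/-- The direction left is coded by `0`, and right by `1`. -/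
def dirCode : Turing.Dir → ℕ
  | .left => 0
  | .right => 1

/-- `g` is a Gödel number of `M`, relative to codings `cA` of the actions (including `τ`) and `cD` of
the tape symbols as natural numbers: for some enumeration of the states of `M` as `0, …, n - 1`, it is
the code (through the standard pairing and list codings of Mathlib) of the number of states, the
initial state, a list of the final states, and a list of the transitions. -/
def IsGodelNumber {Act D : Type*} (cA : Option Act → ℕ) (cD : Option D → ℕ)
    (M : RTM Act D) (g : ℕ) : Prop :=
  ∃ (n : ℕ) (e : M.State ≃ Fin n) (fs : List ℕ) (ts : List (ℕ × ℕ × ℕ × ℕ × ℕ × ℕ)),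
    (∀ k, k ∈ fs ↔ ∃ s ∈ M.final, k = (e s : ℕ)) ∧
    (∀ k, k ∈ ts ↔ ∃ s d a d' m t, M.trans s d a d' m t ∧
      k = ((e s : ℕ), cD d, cA a, cD d', dirCode m, (e t : ℕ))) ∧
    g = Encodable.encode (n, (e M.init : ℕ), fs, ts)

/-- Every machine over finite alphabets has a Gödel number. -/
theorem exists_isGodelNumber {Act D : Type*} [Finite Act] [Finite D]
    (cA : Option Act → ℕ) (cD : Option D → ℕ) (M : RTM Act D) :
    ∃ g, M.IsGodelNumber cA cD g := by
  classical
  have := M.finite_state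
  obtain ⟨n, ⟨e⟩⟩ := Finite.exists_equiv_fin M.State
  have h1 : {k : ℕ | ∃ s ∈ M.final, k = (e s : ℕ)}.Finite := by
    refine (Set.finite_range (fun s : M.State => (e s : ℕ))).subset ?_
    rintro k ⟨s, -, rfl⟩
    exact ⟨s, rfl⟩
  have h2 : {k : ℕ × ℕ × ℕ × ℕ × ℕ × ℕ | ∃ s d a d' m t, M.trans s d a d' m t ∧
      k = ((e s : ℕ), cD d, cA a, cD d', dirCode m, (e t : ℕ))}.Finite := by
    have hm : (Set.range dirCode).Finite := by
      refine (Set.finite_Iic 1).subset ?_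
      rintro _ ⟨m, rfl⟩
      cases m <;> simp [dirCode]
    have hS := Set.finite_range (fun s : M.State => (e s : ℕ))
    have hA := Set.finite_range cA
    have hD := Set.finite_range cD
    refine (hS.prod (hD.prod (hA.prod (hD.prod (hm.prod hS))))).subset ?_
    rintro k ⟨s, d, a, d', m, t, -, rfl⟩
    exact ⟨⟨s, rfl⟩, ⟨d, rfl⟩, ⟨a, rfl⟩, ⟨d', rfl⟩, ⟨m, rfl⟩, ⟨t, rfl⟩⟩
  exact ⟨_, n, e, h1.toFinset.toList, h2.toFinset.toList, by simp, by simp, rfl⟩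

/-- The deterministic machine that outputs the word `w` along the channel `u`, symbol by symbol,
after which it halts in its unique final state. It never writes a non-blank symbol. -/
def sender {Chan D : Type*} (A : Type*) (u : Chan) (w : List (Option D)) :
    RTM (Action Chan D A) D where
  State := Fin (w.length + 1)
  finite_state := inferInstance
  trans s d a e m t := ∃ i : Fin w.length,
    s = i.castSucc ∧ d = none ∧ a = some (.send u (w.get i)) ∧ e = none ∧ m = .right ∧ t = i.succ
  init := 0
  final := {Fin.last _}

/-- The number `g` in unary: `g + 1` occurrences of `one`, delimited by `lb` and `rb`. -/
def message {D : Type*} (one lb rb : D) (g : ℕ) : List (Option D) :=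
  some lb :: (List.replicate (g + 1) (some one) ++ [some rb])

/-- `U` is universal up to `B` (for machines `M` that do not themselves communicate along the
channel `u`, which is dedicated to the transmission of the Gödel number). -/
def UniversalUpTo.{w, w', c, d, a} {Chan : Type c} {D : Type d} {A : Type a} (u : Chan)
    (one lb rb : D) (cA : Option (Action Chan D A) → ℕ) (cD : Option D → ℕ) (B : ℕ)
    (U : RTM.{w'} (Action Chan D A) D) : Prop :=
  ∀ M : RTM.{w} (Action Chan D A) D, M.AvoidsChannel u → M.lts.BranchingBoundedBy B →
    ∀ g, M.IsGodelNumber cA cD g →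
      LTS.DivBranchingBisimilar M.lts
        (LTS.par {u} U.lts (sender A u (message one lb rb g)).lts)

end RTM

end ReactiveTM

universe w

/-!
Say that `T₂` refines `T₁` if, up to a relation between their states, both have the same steps,
except that after each of them `T₂` may first have to perform finitely many `τ`-steps to which it
has no alternative. Refinement is transitive, is preserved by parallel composition with the sender,
and implies divergence-preserving branching bisimilarity.

A program of finitely many guarded commands over a computable store is refined by a reactive Turing
machine. Such a machine only has to recompute the store, and the guards that hold in it, each time
a command has been executed. By Mathlib's compilation of partial recursive functions there is a
Post–Turing machine that does this, and a reactive Turing machine can execute it internally and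
offer the enabled commands in its halting states.

The universal program receives and decodes a Gödel number and then interprets the transitions coded
by it. It has one command for each action `a` and each `i < B`, which executes the `i`-th enabled
transition if that is labelled `a`. These commands suffice: on a tape with a single mark in a
suitable place, transitions of the machine with the same source and the same symbol read have
distinct effects, so the bound `B` on the branching degree also bounds the number of enabled
transitions.
-/

namespace ReactiveTM

namespace LTS

/-! ### Refinement up to inevitable `τ`-steps -/

section Refinement

variable {Act : Type*} {T T₁ T₂ T₃ : LTS Act}

/-- From the given state, every run reaches a state with property `P` after finitely many steps,
all of them labelled `τ` and none of them starting in a final state. -/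
inductive Inevitably (T : LTS Act) (P : T.State → Prop) : T.State → Prop
  | here {s : T.State} (h : P s) : Inevitably T P s
  | step {s : T.State} (hfin : s ∉ T.final) (hex : ∃ t, T.tauStep s t)
      (hτ : ∀ a t, T.step s a t → a = none) (h : ∀ t, T.tauStep s t → Inevitably T P t) :
      Inevitably T P s

namespace Inevitably

variable {P Q : T.State → Prop} {s t : T.State}

theorem bind (hs : T.Inevitably P s) (h : ∀ t, P t → T.Inevitably Q t) : T.Inevitably Q s := by
  induction hs with
  | here hP => exact h _ hP
  | step hfin hex hτ _ ih => exact .step hfin hex hτ ih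

theorem mono (hs : T.Inevitably P s) (h : ∀ t, P t → Q t) : T.Inevitably Q s :=
  hs.bind fun t ht => .here (h t ht)

theorem of_unique_step (hfin : s ∉ T.final) (hst : T.tauStep s t)
    (huniq : ∀ a t', T.step s a t' → a = none ∧ t' = t) (ht : T.Inevitably P t) :
    T.Inevitably P s :=
  .step hfin ⟨t, hst⟩ (fun a t' h => (huniq a t' h).1) fun t' h => (huniq none t' h).2 ▸ ht

theorem exists_tauStar (hs : T.Inevitably P s) : ∃ t, T.tauStar s t ∧ P t := by
  induction hs with
  | here hP => exact ⟨_, .refl, hP⟩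
  | step _ hex _ _ ih =>
    obtain ⟨t, hst⟩ := hex
    obtain ⟨r, htr, hr⟩ := ih t hst
    exact ⟨r, .head hst htr, hr⟩

theorem exists_of_path (hs : T.Inevitably P s) (f : ℕ → T.State) (h0 : f 0 = s)
    (hf : ∀ i, T.tauStep (f i) (f (i + 1))) : ∃ i, P (f i) := by
  induction hs generalizing f with
  | here hP => exact ⟨0, h0 ▸ hP⟩
  | step _ _ _ _ ih =>
    obtain ⟨i, hi⟩ := ih (f 1) (h0 ▸ hf 0) (fun i => f (i + 1)) rfl fun i => hf (i + 1)
    exact ⟨i + 1, hi⟩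

end Inevitably

/-- `K` matches the steps of `T₁` and `T₂` exactly, except that after each matched step `T₂` may
need some inevitable `τ`-steps before it is again in a state related by `K`. -/
structure IsRefinement (T₁ T₂ : LTS Act) (K : T₁.State → T₂.State → Prop) : Prop where
  final_iff : ∀ {s t}, K s t → (s ∈ T₁.final ↔ t ∈ T₂.final)
  step_left : ∀ {s t a s'}, K s t → T₁.step s a s' →
    ∃ t', T₂.step t a t' ∧ T₂.Inevitably (K s') t'
  step_right : ∀ {s t a t'}, K s t → T₂.step t a t' →
    ∃ s', T₁.step s a s' ∧ T₂.Inevitably (K s') t'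
  init : T₂.Inevitably (K T₁.init) T₂.init

/-- `T₂` implements `T₁` up to inevitable internal steps of `T₂`. -/
def Refines (T₁ T₂ : LTS Act) : Prop := ∃ K, IsRefinement T₁ T₂ K

variable {K : T₁.State → T₂.State → Prop}

theorem IsRefinement.inevitably (hK : IsRefinement T₁ T₂ K) {P : T₁.State → Prop} {s : T₁.State}
    {t : T₂.State} (hs : T₁.Inevitably P s) (ht : T₂.Inevitably (K s) t) :
    T₂.Inevitably (fun t' => ∃ s', P s' ∧ K s' t') t := by
  induction hs generalizing t with
  | here hP => exact ht.mono fun _ h => ⟨_, hP, h⟩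
  | step hfin hex hτ _ ih =>
    refine ht.bind fun t' hst' => .step (mt (hK.final_iff hst').2 hfin) ?_ ?_ ?_
    · obtain ⟨s', hs'⟩ := hex
      obtain ⟨t'', ht'', -⟩ := hK.step_left hst' hs'
      exact ⟨t'', ht''⟩
    · intro a t'' ht''
      obtain ⟨s', hs', -⟩ := hK.step_right hst' ht''
      exact hτ a s' hs'
    · intro t'' ht''
      obtain ⟨s', hs', hst''⟩ := hK.step_right hst' ht''
      exact ih s' hs' hst''

theorem Refines.trans : Refines T₁ T₂ → Refines T₂ T₃ → Refines T₁ T₃ := by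
  rintro ⟨K, hK⟩ ⟨L, hL⟩
  refine ⟨fun s r => ∃ t, K s t ∧ L t r, ?_, ?_, ?_, hL.inevitably hK.init hL.init⟩
  · rintro s r ⟨t, hst, htr⟩
    exact (hK.final_iff hst).trans (hL.final_iff htr)
  · rintro s r a s' ⟨t, hst, htr⟩ hs
    obtain ⟨t', ht, hst'⟩ := hK.step_left hst hs
    obtain ⟨r', hr, htr'⟩ := hL.step_left htr ht
    exact ⟨r', hr, hL.inevitably hst' htr'⟩
  · rintro s r a r' ⟨t, hst, htr⟩ hr
    obtain ⟨t', ht, htr'⟩ := hL.step_right htr hr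
    obtain ⟨s', hs, hst'⟩ := hK.step_right hst ht
    exact ⟨s', hs, hL.inevitably hst' htr'⟩

theorem IsRefinement.isBranchingBisimulation (hK : IsRefinement T₁ T₂ K) :
    IsBranchingBisimulation T₁ T₂ fun s t => T₂.Inevitably (K s) t where
  step_left s t hst a s' hs := by
    obtain ⟨r, htr, hsr⟩ := hst.exists_tauStar
    obtain ⟨r', hr, hsr'⟩ := hK.step_left hsr hs
    exact ⟨r, r', htr, .inl hr, .here hsr, hsr'⟩
  step_right s t hst a t' ht := by
    cases hst with
    | here hst =>
      obtain ⟨s', hs, hst'⟩ := hK.step_right hst ht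
      exact ⟨s, s', .refl, .inl hs, .here hst, hst'⟩
    | step hfin hex hτ h =>
      obtain rfl := hτ a t' ht
      exact ⟨s, s, .refl, .inr ⟨rfl, rfl⟩, .step hfin hex hτ h, h t' ht⟩
  final_left s t hst hs := by
    obtain ⟨r, htr, hsr⟩ := hst.exists_tauStar
    exact ⟨r, htr, .here hsr, (hK.final_iff hsr).1 hs⟩
  final_right s t hst ht := by
    cases hst with
    | here hst => exact ⟨s, .refl, .here hst, (hK.final_iff hst).2 ht⟩
    | step hfin => exact absurd ht hfin

theorem IsRefinement.isDivergencePreserving (hK : IsRefinement T₁ T₂ K) :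
    IsDivergencePreserving T₁ T₂ fun s t => T₂.Inevitably (K s) t where
  div_left s t hst f h0 hf := by
    obtain ⟨r, htr, hsr⟩ := hst.exists_tauStar
    obtain ⟨r', hr, hsr'⟩ := hK.step_left hsr (h0 ▸ (hf 0).1)
    exact ⟨r', .tail' htr hr, 1, hsr'⟩
  div_right s t hst f h0 hf := by
    obtain ⟨i, hi⟩ := hst.exists_of_path f h0 fun i => (hf i).1
    obtain ⟨s', hs, hst'⟩ := hK.step_right hi (hf i).1
    exact ⟨s', .single hs, i + 1, hst'⟩

theorem Refines.divBranchingBisimilar : Refines T₁ T₂ → DivBranchingBisimilar T₁ T₂ :=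
  fun ⟨_, hK⟩ => ⟨_, hK.isBranchingBisimulation, hK.isDivergencePreserving, hK.init⟩

end Refinement

section Parallel

variable {Chan D A : Type*} {C : Set Chan}

/-- The action is a communication along one of the channels in `C`. -/
def IsCommunication (C : Set Chan) (a : Option (Action Chan D A)) : Prop :=
  ∃ c ∈ C, ∃ d, a = some (.send c d) ∨ a = some (.recv c d)

/-- Pairs of actions that synchronise along one of the channels in `C`. -/
def Complementary (C : Set Chan) (a b : Option (Action Chan D A)) : Prop :=
  ∃ c ∈ C, ∃ d, a = some (.send c d) ∧ b = some (.recv c d) ∨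
    a = some (.recv c d) ∧ b = some (.send c d)

theorem not_isCommunication_none : ¬ IsCommunication C (none : Option (Action Chan D A)) := by
  rintro ⟨_, _, _, h | h⟩ <;> cases h

theorem not_complementary_none_left {b : Option (Action Chan D A)} :
    ¬ Complementary C none b := by
  rintro ⟨_, _, _, ⟨h, -⟩ | ⟨h, -⟩⟩ <;> cases h

variable {T T₁ T₂ S : LTS (Action Chan D A)}

theorem par_step_iff (hS : ∀ y a y', S.step y a y' → IsCommunication C a)
    {p q : (par C T S).State} {a : Option (Action Chan D A)} :
    (par C T S).step p a q ↔ ¬ IsCommunication C a ∧ T.step p.1 a q.1 ∧ p.2 = q.2 ∨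
      a = none ∧ ∃ b b', Complementary C b b' ∧ T.step p.1 b q.1 ∧ S.step p.2 b' q.2 := by
  constructor
  · rintro ⟨hC, h | ⟨h, -⟩ | ⟨rfl, c, hc, d, h | h⟩⟩
    · exact .inl ⟨hC, h⟩
    · exact absurd (hS _ _ _ h) hC
    · exact .inr ⟨rfl, _, _, ⟨c, hc, d, .inl ⟨rfl, rfl⟩⟩, h⟩
    · exact .inr ⟨rfl, _, _, ⟨c, hc, d, .inr ⟨rfl, rfl⟩⟩, h⟩
  · rintro (⟨hC, h⟩ | ⟨rfl, _, _, ⟨c, hc, d, ⟨rfl, rfl⟩ | ⟨rfl, rfl⟩⟩, h⟩)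
    · exact ⟨hC, .inl h⟩
    · exact ⟨not_isCommunication_none, .inr (.inr ⟨rfl, c, hc, d, .inl h⟩)⟩
    · exact ⟨not_isCommunication_none, .inr (.inr ⟨rfl, c, hc, d, .inr h⟩)⟩

theorem Inevitably.par (hS : ∀ y a y', S.step y a y' → IsCommunication C a)
    {P : T.State → Prop} {t : T.State} (h : T.Inevitably P t) (y : S.State) :
    (par C T S).Inevitably (fun q => P q.1 ∧ q.2 = y) (t, y) := by
  induction h with
  | here hP => exact .here ⟨hP, rfl⟩
  | @step t hfin hex hτ _ ih =>
    have htau : ∀ a q, (LTS.par C T S).step (t, y) a q → a = none ∧ T.tauStep t q.1 ∧ y = q.2 := by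
      intro a q hq
      obtain ⟨-, ht, rfl⟩ | ⟨-, b, b', hb, ht, -⟩ := (par_step_iff hS).1 hq
      · obtain rfl := hτ _ _ ht
        exact ⟨rfl, ht, rfl⟩
      · obtain rfl := hτ _ _ ht
        exact absurd hb not_complementary_none_left
    refine .step (fun h => hfin h.1) ?_ (fun a q hq => (htau a q hq).1) ?_
    · obtain ⟨t', ht⟩ := hex
      exact ⟨(t', y), (par_step_iff hS).2 (.inl ⟨not_isCommunication_none, ht, rfl⟩)⟩
    · rintro ⟨t', y'⟩ hq
      obtain ⟨-, ht, rfl⟩ := htau _ _ hq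
      exact ih t' ht

theorem Refines.par (hS : ∀ y a y', S.step y a y' → IsCommunication C a) :
    Refines T₁ T₂ → Refines (par C T₁ S) (par C T₂ S) := by
  rintro ⟨K, hK⟩
  have lift {s : T₁.State} {t : T₂.State} (y : S.State) (h : T₂.Inevitably (K s) t) :
      (LTS.par C T₂ S).Inevitably (fun q => K s q.1 ∧ y = q.2) (t, y) :=
    (h.par hS y).mono fun _ hq => ⟨hq.1, hq.2.symm⟩
  refine ⟨fun p q => K p.1 q.1 ∧ p.2 = q.2, ?_, ?_, ?_, lift _ hK.init⟩
  · rintro ⟨s, y⟩ ⟨t, _⟩ ⟨hst, rfl⟩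
    exact and_congr_left fun _ => hK.final_iff hst
  · rintro ⟨s, y⟩ ⟨t, _⟩ a ⟨s', y'⟩ ⟨hst, rfl⟩ hs
    obtain ⟨hC, hs, rfl⟩ | ⟨rfl, b, b', hb, hs, hy⟩ := (par_step_iff hS).1 hs
    · obtain ⟨t', ht, hst'⟩ := hK.step_left hst hs
      exact ⟨(t', y), (par_step_iff hS).2 (.inl ⟨hC, ht, rfl⟩), lift y hst'⟩
    · obtain ⟨t', ht, hst'⟩ := hK.step_left hst hs
      exact ⟨(t', y'), (par_step_iff hS).2 (.inr ⟨rfl, b, b', hb, ht, hy⟩), lift y' hst'⟩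
  · rintro ⟨s, y⟩ ⟨t, _⟩ a ⟨t', y'⟩ ⟨hst, rfl⟩ ht
    obtain ⟨hC, ht, rfl⟩ | ⟨rfl, b, b', hb, ht, hy⟩ := (par_step_iff hS).1 ht
    · obtain ⟨s', hs, hst'⟩ := hK.step_right hst ht
      exact ⟨(s', y), (par_step_iff hS).2 (.inl ⟨hC, hs, rfl⟩), lift y hst'⟩
    · obtain ⟨s', hs, hst'⟩ := hK.step_right hst ht
      exact ⟨(s', y'), (par_step_iff hS).2 (.inr ⟨rfl, b, b', hb, hs, hy⟩), lift y' hst'⟩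

end Parallel

end LTS

open Turing

/-! ### Starting a machine on a nonblank tape -/

section Tape

variable {Γ : Type*} [Inhabited Γ]

theorem head_move_left_mk₁ (l : List Γ) : ((Tape.mk₁ l).move .left).head = default := rfl

theorem write_move_left_mk₁ (a : Γ) (l : List Γ) :
    ((Tape.mk₁ l).move .left).write a = Tape.mk₁ (a :: l) := by
  simp [Tape.mk₁, Tape.mk₂]

theorem write_default_move_left_mk₁ (l : List Γ) :
    (((Tape.mk₁ l).move .left).write default).move .right = Tape.mk₁ l := by
  rw [← head_move_left_mk₁ l, Tape.write_self, Tape.move_left_right]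

theorem cons_default_nil : ListBlank.cons default (ListBlank.mk ([] : List Γ)) = ListBlank.mk [] :=
  ListBlank.ext fun i => by cases i <;> simp [ListBlank.nth_mk]

theorem move_left_mk₁_nil : (Tape.mk₁ ([] : List Γ)).move .left = Tape.mk₁ [] :=
  congrArg (Tape.mk default (ListBlank.mk [])) cons_default_nil

end Tape

namespace RTM

variable {Act D : Type*}

theorem inevitably_of_unique_trans {M : RTM Act D} {P : M.lts.State → Prop} {s t : M.State}
    {T : Tape (Option D)} {d e : Option D} {m : Dir} (hfin : s ∉ M.final) (hd : T.head = d)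
    (h : M.trans s d none e m t)
    (huniq : ∀ {a e' m' t'}, M.trans s d a e' m' t' → a = none ∧ e' = e ∧ m' = m ∧ t' = t)
    (ht : M.lts.Inevitably P (t, (T.write e).move m)) : M.lts.Inevitably P (s, T) := by
  subst hd
  refine .of_unique_step hfin ⟨e, m, h, rfl⟩ ?_ ht
  rintro a ⟨t', _⟩ ⟨e', m', h', rfl⟩
  obtain ⟨rfl, rfl, rfl, rfl⟩ := huniq h'
  exact ⟨rfl, rfl⟩

/-- The transition system of `M`, started on the given tape instead of the blank one. -/
def ltsFrom (M : RTM Act D) (tape : Tape (Option D)) : LTS Act where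
  State := M.lts.State
  step := M.lts.step
  init := (M.init, tape)
  final := M.lts.final

theorem inevitably_ltsFrom {M : RTM Act D} {tape : Tape (Option D)}
    {P : M.lts.State → Prop} {c : M.lts.State} (h : M.lts.Inevitably P c) :
    (M.ltsFrom tape).Inevitably P c := by
  induction h with
  | here h => exact .here h
  | step hfin hex hτ _ ih => exact .step hfin hex hτ ih

/-- The transitions of `boot`. The word is written from right to left, and in the state `Sum.inl i`
its first `i` symbols are yet to be written. -/
inductive BootTrans (M : RTM Act D) (word : List (Option D)) :
    Fin (word.length + 1) ⊕ M.State → Option D → Option Act → Option D → Dir →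
      Fin (word.length + 1) ⊕ M.State → Prop
  | write (i : Fin word.length) :
      BootTrans M word (.inl i.succ) none none word[i] .left (.inl i.castSucc)
  | start : BootTrans M word (.inl 0) none none none .right (.inr M.init)
  | run {s d a e m t} (h : M.trans s d a e m t) : BootTrans M word (.inr s) d a e m (.inr t)

/-- The machine that writes a word on the tape before it behaves as `M`. -/
def boot (M : RTM Act D) (word : List (Option D)) : RTM Act D where
  State := Fin (word.length + 1) ⊕ M.State
  finite_state := have := M.finite_state; inferInstance
  trans := BootTrans M word
  init := .inl (Fin.last _)
  final := .inr '' M.final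

variable {M : RTM Act D} {word : List (Option D)}

theorem boot_inevitably_start (i : Fin (word.length + 1)) :
    (M.boot word).lts.Inevitably (· = (.inr M.init, Tape.mk₁ word))
      (.inl i, (Tape.mk₁ (word.drop i)).move .left) := by
  have hfin (i) : .inl i ∉ (M.boot word).final := by rintro ⟨_, _, ⟨⟩⟩
  induction i using Fin.induction with
  | zero =>
    refine inevitably_of_unique_trans (hfin 0) (head_move_left_mk₁ _) .start ?_ (.here ?_)
    · intro a e m t h
      generalize hi : (0 : Fin (word.length + 1)) = i at h
      cases h with
      | write i => exact absurd hi (Fin.succ_ne_zero i).symm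
      | start => exact ⟨rfl, rfl, rfl, rfl⟩
    · exact congrArg (Prod.mk _) (write_default_move_left_mk₁ word)
  | succ i ih =>
    refine inevitably_of_unique_trans (hfin _) (head_move_left_mk₁ _) (.write i) ?_ ?_
    · intro a e m t h
      generalize hj : i.succ = j at h
      cases h with
      | write j => obtain rfl := Fin.succ_injective _ hj; exact ⟨rfl, rfl, rfl, rfl⟩
      | start => exact absurd hj (Fin.succ_ne_zero i)
    · rwa [write_move_left_mk₁, Fin.getElem_fin, Fin.val_succ, ← List.drop_eq_getElem_cons i.2]

theorem refines_boot : LTS.Refines (M.ltsFrom (Tape.mk₁ word)) (M.boot word).lts := by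
  refine ⟨fun c c' => c' = (.inr c.1, c.2), ?_, ?_, ?_, ?_⟩
  · rintro ⟨s, T⟩ _ rfl
    exact (Function.Injective.mem_set_image (f := Sum.inr) Sum.inr_injective (a := s)).symm
  · rintro ⟨s, T⟩ _ a ⟨s', T'⟩ rfl ⟨e, m, h, h'⟩
    exact ⟨(.inr s', T'), ⟨e, m, .run h, h'⟩, .here rfl⟩
  · rintro ⟨s, T⟩ _ a ⟨t, T'⟩ rfl ⟨e, m, h, h'⟩
    cases h with
    | run h => exact ⟨(_, T'), ⟨e, m, h, h'⟩, .here rfl⟩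
  · have := boot_inevitably_start (M := M) (Fin.last word.length)
    rwa [Fin.val_last, List.drop_length, move_left_mk₁_nil] at this

end RTM

/-! ### Hosting a Post–Turing machine in a reactive Turing machine -/

section Host

variable {Act D Q : Type*} [Inhabited Q]

/-- The states of a host of a Post–Turing machine with states `Q`. A Post–Turing machine does not
move its head when it writes, but a reactive Turing machine does: in the state `back q` the head is
one cell too far to the right. -/
inductive HostState (Q : Type*)
  | run (q : Q)
  | back (q : Q)

instance [Finite Q] : Finite (HostState Q) := by
  refine Finite.of_surjective (Sum.elim .run .back : Q ⊕ Q → HostState Q) ?_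
  rintro (q | q)
  exacts [⟨.inl q, rfl⟩, ⟨.inr q, rfl⟩]

/-- The transitions of `host`. -/
inductive HostTrans (N : TM0.Machine (Option D) Q) (offer : Q → Option Act → Q → Prop) :
    HostState Q → Option D → Option Act → Option D → Dir → HostState Q → Prop
  | move {q d q' m} (h : N q d = some (q', .move m)) :
      HostTrans N offer (.run q) d none d m (.run q')
  | write {q d q' e} (h : N q d = some (q', .write e)) :
      HostTrans N offer (.run q) d none e .right (.back q')
  | back (q d) : HostTrans N offer (.back q) d none d .left (.run q)
  | offer {q a q'} (h : offer q a q') (d) : HostTrans N offer (.run q) d a d .right (.back q')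

/-- The reactive Turing machine that behaves internally as the Post–Turing machine `N`, and moreover
offers in each state `q` the actions `a` with `offer q a q'`, which do not change the tape. -/
def host [Finite Q] (N : TM0.Machine (Option D) Q) (offer : Q → Option Act → Q → Prop)
    (final : Set Q) (init : Q) : RTM Act D where
  State := HostState Q
  finite_state := inferInstance
  trans := HostTrans N offer
  init := .run init
  final := .run '' final

variable [Finite Q] {N : TM0.Machine (Option D) Q} {offer : Q → Option Act → Q → Prop}
  {final : Set Q} {init : Q}

theorem run_mem_host_final {q : Q} : .run q ∈ (host N offer final init).final ↔ q ∈ final := by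
  constructor
  · rintro ⟨_, hq, ⟨⟩⟩
    exact hq
  · exact fun hq => ⟨q, hq, rfl⟩

theorem host_inevitably_run (q : Q) (T : Tape (Option D)) :
    (host N offer final init).lts.Inevitably (· = (.run q, T)) (.back q, T.move .right) := by
  refine RTM.inevitably_of_unique_trans (by rintro ⟨_, _, ⟨⟩⟩) rfl (.back q _) ?_ (.here ?_)
  · intro a e m t h
    cases h
    exact ⟨rfl, rfl, rfl, rfl⟩
  · rw [Tape.write_self, Tape.move_right_left]

theorem host_inevitably_step (hoffer : ∀ q a q', offer q a q' → ∀ d, N q d = none)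
    (hfinal : ∀ q ∈ final, ∀ d, N q d = none) {c c' : TM0.Cfg (Option D) Q}
    (h : TM0.step N c = some c') :
    (host N offer final init).lts.Inevitably (· = (.run c'.q, c'.Tape)) (.run c.q, c.Tape) := by
  obtain ⟨q, T⟩ := c
  obtain ⟨⟨q', stmt⟩, hN, rfl⟩ := Option.map_eq_some_iff.1 h
  have hq : .run q ∉ (host N offer final init).final := fun hq => by
    rw [hfinal q (run_mem_host_final.1 hq)] at hN
    cases hN
  have hoff (a q'') : ¬ offer q a q'' := fun h => by
    rw [hoffer _ _ _ h] at hN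
    cases hN
  cases stmt with
  | move m =>
    refine RTM.inevitably_of_unique_trans hq rfl (.move hN) ?_ (.here ?_)
    · intro a e m' t h
      cases h with
      | move h => rw [hN] at h; cases h; exact ⟨rfl, rfl, rfl, rfl⟩
      | write h => rw [hN] at h; cases h
      | offer h => exact absurd h (hoff _ _)
    · rw [Tape.write_self]
  | write e =>
    refine RTM.inevitably_of_unique_trans hq rfl (.write hN) ?_ (host_inevitably_run _ _)
    intro a e' m t h
    cases h with
    | move h => rw [hN] at h; cases h
    | write h => rw [hN] at h; cases h; exact ⟨rfl, rfl, rfl, rfl⟩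
    | offer h => exact absurd h (hoff _ _)

theorem host_inevitably_reaches (hoffer : ∀ q a q', offer q a q' → ∀ d, N q d = none)
    (hfinal : ∀ q ∈ final, ∀ d, N q d = none) {c c' : TM0.Cfg (Option D) Q}
    (h : StateTransition.Reaches (TM0.step N) c c') :
    (host N offer final init).lts.Inevitably (· = (.run c'.q, c'.Tape)) (.run c.q, c.Tape) := by
  induction h with
  | refl => exact .here rfl
  | tail _ h ih =>
    exact ih.bind fun _ hs => hs ▸ host_inevitably_step hoffer hfinal (Option.mem_def.1 h)

theorem host_step_iff {q : Q} (hq : ∀ d, N q d = none) {T : Tape (Option D)} {a : Option Act}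
    {c : (host N offer final init).lts.State} :
    (host N offer final init).lts.step (.run q, T) a c ↔
      ∃ q', offer q a q' ∧ c = (.back q', T.move .right) := by
  constructor
  · obtain ⟨t, T'⟩ := c
    rintro ⟨e, m, h, rfl⟩
    cases h with
    | move h => rw [hq] at h; cases h
    | write h => rw [hq] at h; cases h
    | offer h => exact ⟨_, h, by rw [Tape.write_self]⟩
  · rintro ⟨q', h, rfl⟩
    exact ⟨_, _, .offer h _, by rw [Tape.write_self]⟩

end Host

open StateTransition

/-! ### Simulating a stack machine by a finite Post–Turing machine -/

section Restrict

variable {Γ Δ Q : Type*} [Inhabited Γ] [Inhabited Δ] [Inhabited Q]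

theorem exists_tm0_restrict {N : TM0.Machine Γ Q} {S : Set Q} (ss : TM0.Supports N S)
    (f : PointedMap Γ Δ) (g : PointedMap Δ Γ) (hfg : Function.RightInverse f g) :
    ∃ (_ : Inhabited S) (N' : TM0.Machine Δ S),
      (∀ q : S, (∀ a, N q a = none) → ∀ a, N' q a = none) ∧
      ∀ {c c' : TM0.Cfg Γ Q} (hc : c.q ∈ S), Reaches (TM0.step N) c c' →
        ∃ hc' : c'.q ∈ S, Reaches (TM0.step N') ⟨⟨c.q, hc⟩, c.Tape.map f⟩
          ⟨⟨c'.q, hc'⟩, c'.Tape.map f⟩ := by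
  classical
  let _ : Inhabited S := ⟨⟨default, ss.1⟩⟩
  let restrict : PointedMap Q S := ⟨fun q => if hq : q ∈ S then ⟨q, hq⟩ else default, by
    rw [dif_pos ss.1]; rfl⟩
  have restrict_of_mem {q : Q} (hq : q ∈ S) : restrict q = ⟨q, hq⟩ := dif_pos hq
  refine ⟨inferInstance, N.map f g restrict Subtype.val, ?_, ?_⟩
  · intro q hq a
    simp only [TM0.Machine.map, hq, Option.map_none]
  · intro c c' hc h
    obtain ⟨_, ⟨hc', rfl⟩, h'⟩ := tr_reaches (TM0.Machine.map_respects N f g restrict Subtype.val ss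
      hfg fun q hq => congrArg Subtype.val (restrict_of_mem hq)) ⟨hc, rfl⟩ h
    refine ⟨hc', ?_⟩
    rwa [← restrict_of_mem hc, ← restrict_of_mem hc']

end Restrict

section Compile

variable {K : Type} [DecidableEq K] {Γ : K → Type} {Λ σ : Type} [Inhabited Λ] [Inhabited σ]

/-- A Post–Turing machine with finitely many states and tape alphabet `Δ` that simulates the stack
machine `M`, from any label in `S` until `M` halts, after which the simulation can be resumed. -/
structure StackSimulation (M : Λ → TM2.Stmt Γ Λ σ) (S : Set Λ) (Δ : Type*) [Inhabited Δ] where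
  Q : Type
  [inhabited : Inhabited Q]
  [finite : Finite Q]
  machine : TM0.Machine Δ Q
  /-- The state that represents a label together with a local store. -/
  entry : Λ → σ → Q
  /-- The local store of the stack machine, in states that represent a halted stack machine. -/
  result : Q → Option σ
  Represents : (∀ k, List (Γ k)) → Tape Δ → Prop
  halts : ∀ {q v}, result q = some v → ∀ a, machine q a = none
  exists_result : ∀ v, ∃ q, result q = some v
  exists_represents : ∀ k L, ∃ w, Represents (Function.update (fun _ => []) k L) (Tape.mk₁ w)
  reaches : ∀ {l v stk v' stk' T}, l ∈ S → Represents stk T →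
    Reaches (TM2.step M) ⟨some l, v, stk⟩ ⟨none, v', stk'⟩ →
    ∃ q T', result q = some v' ∧ Represents stk' T' ∧
      Reaches (TM0.step machine) ⟨entry l v, T⟩ ⟨q, T'⟩

variable {n : ℕ} (enc : TM2to1.Γ' K Γ → List.Vector Bool n)
  (dec : List.Vector Bool n → TM2to1.Γ' K Γ) (M : Λ → TM2.Stmt Γ Λ σ)

/-- The translation of a stack machine to a one-tape machine over `Bool`. -/
abbrev oneTape : TM1to1.Λ' (TM2to1.Γ' K Γ) (TM2to1.Λ' K Γ Λ σ) σ →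
    TM1.Stmt Bool (TM1to1.Λ' (TM2to1.Γ' K Γ) (TM2to1.Λ' K Γ Λ σ) σ) σ :=
  TM1to1.tr enc dec (TM2to1.tr M)

/-- The state of the Post–Turing machine `TM1to0.tr (oneTape enc dec M)` that represents a label
(or `none` if `M` has halted) together with a local store. -/
def oneTapeState (l : Option Λ) (v : σ) : TM1to0.Λ' (oneTape enc dec M) :=
  (((l.map .normal).map .normal).map (oneTape enc dec M), v)

variable {enc}

/-- The tape over `Bool` represents the contents of the stacks. -/
def IsStackTape (enc0 : enc default = List.Vector.replicate n false) (stk : ∀ k, List (Γ k))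
    (T : Tape Bool) : Prop :=
  ∃ L : ListBlank (∀ k, Option (Γ k)),
    (∀ k, L.map (proj k) = ListBlank.mk ((stk k).map some).reverse) ∧
      T = TM1to1.trTape enc0 (Tape.mk' ∅ (TM2to1.addBottom L))

theorem exists_isStackTape_mk₁ (enc0 : enc default = List.Vector.replicate n false) (k : K)
    (L : List (Γ k)) :
    ∃ w, IsStackTape enc0 (Function.update (fun _ => []) k L) (Tape.mk₁ w) := by
  refine ⟨(TM2to1.trInit k L).flatMap fun a => (enc a).toList, ?_⟩
  have hinit := TM2to1.trCfg_init (Λ := Unit) (σ := Unit) k L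
  generalize hc : (TM1.init (TM2to1.trInit k L) :
    TM1.Cfg (TM2to1.Γ' K Γ) (TM2to1.Λ' K Γ Unit Unit) Unit) = c at hinit
  obtain ⟨L', hL'⟩ := hinit
  have htape : Tape.mk₁ (TM2to1.trInit k L) = Tape.mk' ∅ (TM2to1.addBottom L') :=
    congrArg TM1.Cfg.Tape hc
  refine ⟨L', hL', ?_⟩
  rw [← htape]
  simp only [Tape.mk₁, Tape.mk₂, TM1to1.trTape_mk', TM1to1.trTape', ListBlank.flatMap_mk]
  rfl

variable {dec} {M}

theorem reaches_oneTape (enc0 : enc default = List.Vector.replicate n false)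
    (encdec : ∀ a, dec (enc a) = a) {c c' : TM2.Cfg Γ Λ σ} {T : Tape Bool}
    (hT : IsStackTape enc0 c.stk T) (h : Reaches (TM2.step M) c c') :
    ∃ T', IsStackTape enc0 c'.stk T' ∧ Reaches (TM0.step (TM1to0.tr (oneTape enc dec M)))
      ⟨oneTapeState enc dec M c.l c.var, T⟩ ⟨oneTapeState enc dec M c'.l c'.var, T'⟩ := by
  obtain ⟨L, hL, rfl⟩ := hT
  obtain ⟨c₁, ⟨L', hL'⟩, h₁⟩ := tr_reaches (TM2to1.tr_respects M) (.mk L hL) h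
  obtain ⟨c₂, rfl, h₂⟩ := tr_reaches
    (TM1to1.tr_respects (enc0 := enc0) dec (TM2to1.tr M) encdec) rfl h₁
  obtain ⟨c₃, rfl, h₃⟩ := tr_reaches (TM1to0.tr_respects (oneTape enc dec M)) rfl h₂
  exact ⟨_, ⟨L', hL', rfl⟩, h₃⟩

variable [Finite K] [∀ k, Finite (Γ k)] [Finite σ]

theorem exists_supports_oneTape {S : Finset Λ} (ss : TM2.Supports M S) :
    ∃ S' : Finset (TM1to0.Λ' (oneTape enc dec M)),
      TM0.Supports (TM1to0.tr (oneTape enc dec M)) S' ∧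
      (∀ l ∈ S, ∀ v, oneTapeState enc dec M (some l) v ∈ S') ∧
      ∀ v, oneTapeState enc dec M none v ∈ S' := by
  classical
  have := Fintype.ofFinite K
  have := fun k => Fintype.ofFinite (Γ k)
  have := Fintype.ofFinite σ
  have s₁ := TM2to1.tr_supports M ss
  have s₂ := TM1to1.tr_supports enc dec (TM2to1.tr M) s₁
  refine ⟨_, TM1to0.tr_supports _ s₂, fun l hl v => ?_, fun v => ?_⟩
  · have h₁ : TM2to1.Λ'.normal l ∈ TM2to1.trSupp M S :=
      Finset.mem_biUnion.2 ⟨l, hl, Finset.mem_insert_self _ _⟩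
    have h₂ : TM1to1.Λ'.normal (TM2to1.Λ'.normal l) ∈
        TM1to1.trSupp (TM2to1.tr M) (TM2to1.trSupp M S) :=
      Finset.mem_biUnion.2 ⟨_, h₁, Finset.mem_insert_self _ _⟩
    exact Finset.mem_product.2
      ⟨Finset.some_mem_insertNone.2 (Finset.mem_biUnion.2 ⟨_, h₂, TM1.stmts₁_self⟩),
        Finset.mem_univ _⟩
  · exact Finset.mem_product.2 ⟨Finset.none_mem_insertNone, Finset.mem_univ _⟩

theorem nonempty_stackSimulation {S : Finset Λ} (ss : TM2.Supports M S) {Δ : Type*} [Inhabited Δ]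
    (f : PointedMap Bool Δ) (g : PointedMap Δ Bool) (hfg : Function.RightInverse f g) :
    Nonempty (StackSimulation M S Δ) := by
  classical
  have := Fintype.ofFinite K
  have := fun k => Fintype.ofFinite (Γ k)
  obtain ⟨n, enc, dec, enc0, encdec⟩ := TM1to1.exists_enc_dec (Γ := TM2to1.Γ' K Γ)
  obtain ⟨S', ss', hentry, hexit⟩ := exists_supports_oneTape (enc := enc) (dec := dec) ss
  obtain ⟨_, N, hN, hreaches⟩ := exists_tm0_restrict ss' f g hfg
  refine ⟨{
    Q := S'
    machine := N
    entry l v := if h : oneTapeState enc dec M (some l) v ∈ S' then ⟨_, h⟩ else default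
    result q := if q.1.1 = none then some q.1.2 else none
    Represents stk T := ∃ T', IsStackTape enc0 stk T' ∧ T = T'.map f
    halts {q v} hq a := hN q (fun a => ?_) a
    exists_result v := ⟨⟨_, hexit v⟩, rfl⟩
    exists_represents k L := ?_
    reaches {l v stk v' stk' T} hl hT h := ?_ }⟩
  · obtain ⟨⟨_ | q, v⟩, hq⟩ := q
    · rfl
    · cases hq
  · obtain ⟨w, hw⟩ := exists_isStackTape_mk₁ enc0 k L
    exact ⟨w.map f, _, hw, (Tape.map_mk₁ f w).symm⟩
  · obtain ⟨T, hT, rfl⟩ := hT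
    obtain ⟨T', hT', h'⟩ := reaches_oneTape enc0 encdec hT h
    obtain ⟨hq, h''⟩ := hreaches (hentry l hl v) h'
    refine ⟨⟨_, hq⟩, T'.map f, rfl, ⟨T', hT', rfl⟩, ?_⟩
    rw [dif_pos (hentry l hl v)]
    exact h''

end Compile

/-! ### Reading the result of a computation -/

section Lift

variable {K : Type*} {Γ : K → Type*} {Λ σ τ : Type*}

/-- Extend the local store by a component of type `τ`, and replace halting by a jump to the new
label `none`. -/
def liftStmt : TM2.Stmt Γ Λ σ → TM2.Stmt Γ (Option Λ) (σ × τ)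
  | .push k f q => .push k (fun v => f v.1) (liftStmt q)
  | .peek k f q => .peek k (fun v a => (f v.1 a, v.2)) (liftStmt q)
  | .pop k f q => .pop k (fun v a => (f v.1 a, v.2)) (liftStmt q)
  | .load f q => .load (fun v => (f v.1, v.2)) (liftStmt q)
  | .branch f q₁ q₂ => .branch (fun v => f v.1) (liftStmt q₁) (liftStmt q₂)
  | .goto f => .goto fun v => some (f v.1)
  | .halt => .goto fun _ => none

theorem stepAux_liftStmt [DecidableEq K] (q : TM2.Stmt Γ Λ σ) (v : σ) (t : τ)
    (S : ∀ k, List (Γ k)) : TM2.stepAux (liftStmt q) (v, t) S =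
      ⟨some (TM2.stepAux q v S).l, ((TM2.stepAux q v S).var, t), (TM2.stepAux q v S).stk⟩ := by
  induction q generalizing v S with
  | branch f q₁ q₂ ih₁ ih₂ => simp only [liftStmt, TM2.stepAux]; cases f v <;> simp [ih₁, ih₂]
  | _ => simp_all [liftStmt]

theorem supportsStmt_liftStmt {S : Finset Λ} {q : TM2.Stmt Γ Λ σ} (h : TM2.SupportsStmt S q) :
    TM2.SupportsStmt S.insertNone (liftStmt q : TM2.Stmt Γ (Option Λ) (σ × τ)) := by
  induction q <;> simp_all [liftStmt, TM2.SupportsStmt]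

theorem reaches_of_eq_liftStmt [DecidableEq K] {M : Λ → TM2.Stmt Γ Λ σ}
    {M' : Option Λ → TM2.Stmt Γ (Option Λ) (σ × τ)} (h : ∀ l, M' (some l) = liftStmt (M l))
    (t : τ) {c c' : TM2.Cfg Γ Λ σ} (hc : Reaches (TM2.step M) c c') :
    Reaches (TM2.step M') ⟨some c.l, (c.var, t), c.stk⟩ ⟨some c'.l, (c'.var, t), c'.stk⟩ := by
  induction hc with
  | refl => exact .refl
  | @tail d e _ hde ih =>
    refine ih.tail ?_
    obtain ⟨- | l, v, S⟩ := d
    · cases hde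
    · cases hde
      simp [h, stepAux_liftStmt]

end Lift

section Read

open PartrecToTM2

variable {R : Type} [Semiring R]

/-- Reads one more binary digit of a number, given least significant digit first: the first
component is the value of the digits read so far, the second one the value of the next digit. Over a
finite semiring this is a finite automaton. -/
def readDigit : R × R → Γ' → R × R
  | (s, p), .bit1 => (s + p, p + p)
  | (s, p), _ => (s, p + p)

theorem fst_foldl_readDigit (n : ℕ) (s p : R) :
    ((trNat n).foldl readDigit (s, p)).1 = s + p * n := by
  have hpos (m : PosNum) (s p : R) : ((trPosNum m).foldl readDigit (s, p)).1 = s + p * m := by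
    induction m generalizing s p with
    | one => simp [trPosNum, readDigit]
    | bit0 m ih =>
      simp only [trPosNum, List.foldl_cons, readDigit, ih, PosNum.cast_bit0, mul_add, add_mul]
    | bit1 m ih =>
      simp only [trPosNum, List.foldl_cons, readDigit, ih, PosNum.cast_bit1, mul_add, add_mul,
        mul_one]
      abel
  have hnum (m : Num) : ((trNum m).foldl readDigit (s, p)).1 = s + p * m := by
    cases m with
    | zero => simp [trNum]
    | pos m => exact hpos m s p
  rw [trNat, hnum, ← Num.cast_to_nat, Num.to_of_nat]

variable (R) in
/-- The stack machine that runs a code, and then pops the first number of its result from the main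
stack, leaving the value of this number in `R` in the local store. -/
def readMachine : Option Λ' → TM2.Stmt (fun _ : K' => Γ') (Option Λ') (Option Γ' × R × R)
  | some l => liftStmt (tr l)
  | none => .pop .main (fun v a => (a, v.2)) <|
      .branch (fun v => natEnd (v.1.getD .cons)) (.load (fun v => (none, v.2)) .halt)
        (.load (fun v => (none, readDigit v.2 (v.1.getD .cons))) (.goto fun _ => none))

theorem supports_readMachine {S : Finset Λ'} (h : Supports S S) :
    TM2.Supports (readMachine R) S.insertNone := by
  refine ⟨Finset.none_mem_insertNone, ?_⟩
  rintro (- | l) hl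
  · simp [readMachine, TM2.SupportsStmt]
  · exact supportsStmt_liftStmt (h l (Finset.some_mem_insertNone.1 hl))

theorem reaches_readMachine_none {l : List Γ'} (hl : ∀ x ∈ l, natEnd x = false) (r : List Γ')
    (w : R × R) : Reaches (TM2.step (readMachine R))
      ⟨some none, (none, w), K'.elim (l ++ .cons :: r) [] [] []⟩
      ⟨none, (none, l.foldl readDigit w), K'.elim r [] [] []⟩ := by
  induction l generalizing w with
  | nil =>
    refine .single ?_
    simp [readMachine, TM2.step, TM2.stepAux]
  | cons a l ih =>
    refine .head ?_ (ih (fun x hx => hl x (List.mem_cons_of_mem _ hx)) _)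
    have ha := hl a List.mem_cons_self
    cases a <;> first | exact absurd ha (by decide) | simp [readMachine, TM2.step, TM2.stepAux]

theorem reaches_readMachine {c : ToPartrec.Code} {v ms : List ℕ} {o : ℕ}
    (h : c.eval v = pure (o :: ms)) : ∃ p : R, Reaches (TM2.step (readMachine R))
      ⟨some (some (trNormal c Cont'.halt)), (none, 0, 1), K'.elim (trList v) [] [] []⟩
      ⟨none, (none, o, p), K'.elim (trList ms) [] [] []⟩ := by
  have heval : halt (o :: ms) ∈ eval (TM2.step tr) (init c v) := by
    rw [PartrecToTM2.tr_eval, h]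
    exact ⟨trivial, rfl⟩
  have hrun := reaches_of_eq_liftStmt (M' := readMachine R) (fun _ => rfl) (0, 1)
    (mem_eval.1 heval).1
  have hread := reaches_readMachine_none (trNat_natEnd o) (trList ms) ((0, 1) : R × R)
  refine ⟨((trNat o).foldl readDigit ((0, 1) : R × R)).2, hrun.trans ?_⟩
  rw [← Prod.mk.eta (p := List.foldl _ _ _), fst_foldl_readDigit, zero_add, one_mul] at hread
  exact hread

end Read

section Code

open Encodable

variable {α β γ : Type*} [Primcodable α] [Primcodable β] [Primcodable γ]

theorem exists_code_eval_encode {f : α → β} (hf : Computable f) :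
    ∃ c : ToPartrec.Code, ∀ x, c.eval [encode x] = pure [encode (f x)] := by
  obtain ⟨c, hc⟩ := ToPartrec.Code.exists_code (Nat.Partrec'.part_iff₁.2 (Partrec.nat_iff.2 hf))
  refine ⟨c, fun x => (hc ⟨[encode x], rfl⟩).trans ?_⟩
  simp [List.Vector.head]

theorem exists_code_eval_encode₂ {f : α → β} {g : α → γ} (hf : Computable f) (hg : Computable g) :
    ∃ c : ToPartrec.Code, ∀ x, c.eval [encode x] = pure [encode (f x), encode (g x)] := by
  obtain ⟨c, hc⟩ := exists_code_eval_encode hf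
  obtain ⟨c', hc'⟩ := exists_code_eval_encode hg
  refine ⟨.cons c c', fun x => ?_⟩
  have h : (ToPartrec.Code.cons c c').eval [encode x] =
      (c.eval [encode x]).bind fun a => (c'.eval [encode x]).bind fun b => pure (a.headI :: b) :=
    rfl
  rw [h, hc, hc']
  exact (Part.bind_some _ _).trans (Part.bind_some _ _)

end Code

/-! ### Computable memories and guarded-command programs -/

section Memory

variable {J X O : Type*}

/-- A Post–Turing machine with finitely many states and tape alphabet `Γ` that stores an element of
`X` on its tape. Each time it halts it displays `out x`, where `x` is the element stored; when it is
restarted in the state `entry j`, it replaces `x` by `update j x` before it halts again. -/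
structure MemoryMachine (Γ : Type*) [Inhabited Γ] (update : J → X → X) (out : X → O) where
  Q : Type
  [inhabited : Inhabited Q]
  [finite : Finite Q]
  machine : TM0.Machine Γ Q
  entry : J → Q
  display : Q → Option O
  Represents : X → Tape Γ → Prop
  halts : ∀ {q o}, display q = some o → ∀ a, machine q a = none
  exists_init : ∀ x, ∃ q w, display q = some (out x) ∧ Represents x (Tape.mk₁ w)
  exists_reaches : ∀ j {x T}, Represents x T → ∃ q T', display q = some (out (update j x)) ∧
    Represents (update j x) T' ∧ Reaches (TM0.step machine) ⟨entry j, T⟩ ⟨q, T'⟩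

open PartrecToTM2

instance : Finite K' :=
  Fintype.finite ⟨{.main, .rev, .aux, .stack}, by rintro (_ | _ | _ | _) <;> simp⟩

theorem exists_supports_trNormal {J : Type*} [Finite J] (c : J → ToPartrec.Code) :
    ∃ S : Finset Λ', Supports S S ∧ ∀ j, trNormal (c j) Cont'.halt ∈ S := by
  classical
  have := Fintype.ofFinite J
  let S := Finset.univ.biUnion fun j => codeSupp (c j) Cont'.halt
  have hS (j : J) : codeSupp (c j) Cont'.halt ⊆ S :=
    Finset.subset_biUnion_of_mem (fun j => codeSupp (c j) Cont'.halt) (Finset.mem_univ j)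
  refine ⟨S, fun q hq => ?_, fun j => hS j (codeSupp_self _ _ (trStmts₁_self _))⟩
  obtain ⟨j, -, hq⟩ := Finset.mem_biUnion.1 hq
  exact codeSupp_supports (hS j) q hq

open Encodable

theorem nonempty_memoryMachine [Finite J] [Primcodable X] [Finite O] [Primcodable O]
    {update : J → X → X} {out : X → O} (hupdate : ∀ j, Computable (update j))
    (hout : Computable out) {Γ : Type*} [Inhabited Γ] (f : PointedMap Bool Γ)
    (g : PointedMap Γ Bool) (hfg : Function.RightInverse f g) :
    Nonempty (MemoryMachine Γ update out) := by
  choose c hc using fun j => exists_code_eval_encode₂ (hout.comp (hupdate j)) (hupdate j)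
  obtain ⟨S, hS, hcS⟩ := exists_supports_trNormal c
  obtain ⟨N, hN⟩ := (Set.finite_range (encode : O → ℕ)).bddAbove
  obtain ⟨M⟩ := nonempty_stackSimulation (supports_readMachine (R := ZMod (N + 1)) hS) f g hfg
  have hdecode (x : X) :
      decode (ZMod.val ((encode (out x) : ℕ) : ZMod (N + 1))) = some (out x) := by
    rw [ZMod.val_cast_of_lt (Nat.lt_succ_of_le (hN ⟨_, rfl⟩)), encodek]
  have hstack (l : List Γ') :
      Function.update (fun _ => []) K'.main l = K'.elim l [] [] [] := by
    funext k
    cases k <;> rfl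
  refine ⟨{
    Q := M.Q
    inhabited := M.inhabited
    finite := M.finite
    machine := M.machine
    entry j := M.entry (some (trNormal (c j) Cont'.halt)) (none, 0, 1)
    display q := (M.result q).bind fun v => decode (ZMod.val v.2.1)
    Represents x := M.Represents (K'.elim (trList [encode x]) [] [] [])
    halts {q o} hq := ?_
    exists_init x := ?_
    exists_reaches j x T hT := ?_ }⟩
  · obtain ⟨v, hv, -⟩ := Option.bind_eq_some_iff.1 hq
    exact M.halts hv
  · obtain ⟨q, hq⟩ := M.exists_result (none, encode (out x), 1)
    obtain ⟨w, hw⟩ := M.exists_represents K'.main (trList [encode x])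
    refine ⟨q, w, ?_, hstack _ ▸ hw⟩
    rw [hq]
    exact hdecode x
  · obtain ⟨p, h⟩ := reaches_readMachine (R := ZMod (N + 1)) (hc j x)
    obtain ⟨q, T', hq, hT', h'⟩ := M.reaches (Finset.some_mem_insertNone.2 (hcS j)) hT h
    refine ⟨q, T', ?_, hT', h'⟩
    rw [hq]
    exact hdecode _

end Memory

theorem exists_primcodable_pi (X J α : Type*) [Primcodable X] [Finite J] [Primcodable α] :
    ∃ _ : Primcodable (J → α),
      ∀ f : X → J → α, (∀ j, Computable fun x => f x j) → Computable f := by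
  obtain ⟨n, ⟨e⟩⟩ := Finite.exists_equiv_fin J
  let e' : (J → α) ≃ List.Vector α n :=
    (e.arrowCongr (.refl α)).trans (Equiv.vectorEquivFin α n).symm
  refine ⟨Primcodable.ofEquiv _ e', fun f hf => ?_⟩
  let _ := Primcodable.ofEquiv _ e'
  have h := (Primrec.of_equiv_symm (e := e')).to_comp.comp
    (Computable.vector_ofFn fun i => hf (e.symm i))
  refine h.of_eq fun x => funext fun j => ?_
  change (List.Vector.ofFn fun i => f x (e.symm i)).get (e j) = f x j
  rw [List.Vector.get_ofFn, Equiv.symm_apply_apply]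

/-- A program of guarded commands over a computable store, in the sense of Dijkstra: a command may
be executed, performing the action that labels it, in the states that satisfy its guard. -/
structure GuardedProgram (Act : Type*) where
  State : Type
  [primcodable : Primcodable State]
  Command : Type*
  [finite : Finite Command]
  label : Command → Option Act
  guard : Command → State → Bool
  computable_guard : ∀ j, Computable (guard j)
  update : Command → State → State
  computable_update : ∀ j, Computable (update j)
  init : State
  final : State → Bool
  computable_final : Computable final

namespace GuardedProgram

variable {Act : Type*} (P : GuardedProgram Act)

/-- The transition system of a guarded-command program. -/
def lts : LTS Act where
  State := P.State
  step s a s' := ∃ j, P.label j = a ∧ P.guard j s ∧ s' = P.update j s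
  init := P.init
  final := {s | P.final s}

/-- What determines the commands that may be executed in a state, and whether it is final. -/
def observe (s : P.State) : Bool × (P.Command → Bool) := (P.final s, fun j => P.guard j s)

attribute [instance] primcodable finite

theorem nonempty_memoryMachine {Γ : Type*} [Inhabited Γ] (f : PointedMap Bool Γ)
    (g : PointedMap Γ Bool) (hfg : Function.RightInverse f g) :
    Nonempty (MemoryMachine Γ P.update P.observe) := by
  obtain ⟨_, hpi⟩ := exists_primcodable_pi P.State P.Command Bool
  have := Fintype.ofFinite P.Command
  exact ReactiveTM.nonempty_memoryMachine P.computable_update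
    (P.computable_final.pair (hpi _ P.computable_guard)) f g hfg

variable {P}

section Refines

variable {D : Type*} (M : MemoryMachine (Option D) P.update P.observe)

attribute [local instance] MemoryMachine.inhabited MemoryMachine.finite

/-- Starting the execution of a command that the displayed observation allows. -/
def Offer (q : M.Q) (a : Option Act) (q' : M.Q) : Prop :=
  ∃ o j, M.display q = some o ∧ P.label j = a ∧ o.2 j ∧ q' = M.entry j

/-- The reactive Turing machine that executes a program with the help of a memory machine. -/
def memoryHost (init : M.Q) : RTM Act D :=
  host M.machine (Offer M) {q | ∃ o, M.display q = some o ∧ o.1} init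

variable {M} {init : M.Q}

theorem run_mem_memoryHost_final {q : M.Q} {s : P.State}
    (hq : M.display q = some (P.observe s)) :
    .run q ∈ (memoryHost M init).final ↔ P.final s := by
  refine run_mem_host_final.trans ⟨?_, fun hs => ⟨_, hq, hs⟩⟩
  rintro ⟨o, ho, hs⟩
  cases hq.symm.trans ho
  exact hs

theorem memoryHost_inevitably_reaches {q q' : M.Q} {T T' : Tape (Option D)}
    (h : Reaches (TM0.step M.machine) ⟨q, T⟩ ⟨q', T'⟩) :
    (memoryHost M init).lts.Inevitably (· = (.run q', T')) (.run q, T) := by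
  refine host_inevitably_reaches ?_ ?_ h
  · rintro q a q' ⟨o, j, hq, -⟩
    exact M.halts hq
  · rintro q ⟨o, hq, -⟩
    exact M.halts hq

theorem memoryHost_inevitably_entry {s : P.State} {T : Tape (Option D)} (j : P.Command)
    (hT : M.Represents s T) :
    (memoryHost M init).lts.Inevitably
      (fun c => ∃ q T, c = (.run q, T) ∧ M.display q = some (P.observe (P.update j s)) ∧
        M.Represents (P.update j s) T)
      (.back (M.entry j), T.move .right) := by
  obtain ⟨q, T', hq, hT', h⟩ := M.exists_reaches j hT
  exact (host_inevitably_run _ T).bind fun _ hc => hc ▸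
    (memoryHost_inevitably_reaches h).mono fun _ hc => ⟨q, T', hc, hq, hT'⟩

theorem refines_memoryHost {w : List (Option D)} (hq : M.display init = some (P.observe P.init))
    (hw : M.Represents P.init (Tape.mk₁ w)) :
    P.lts.Refines ((memoryHost M init).ltsFrom (Tape.mk₁ w)) := by
  refine ⟨fun s c => ∃ q T, c = (.run q, T) ∧ M.display q = some (P.observe s) ∧ M.Represents s T,
    ?_, ?_, ?_, .here ⟨init, _, rfl, hq, hw⟩⟩
  · rintro s _ ⟨q, T, rfl, hq, -⟩
    exact (run_mem_memoryHost_final (init := init) hq).symm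
  · rintro s _ a _ ⟨q, T, rfl, hq, hT⟩ ⟨j, rfl, hj, rfl⟩
    exact ⟨_, (host_step_iff (M.halts hq)).2 ⟨_, ⟨_, j, hq, rfl, hj, rfl⟩, rfl⟩,
      RTM.inevitably_ltsFrom (memoryHost_inevitably_entry j hT)⟩
  · rintro s _ a c ⟨q, T, rfl, hq, hT⟩ hc
    obtain ⟨_, ⟨o, j, ho, rfl, hj, rfl⟩, rfl⟩ := (host_step_iff (M.halts hq)).1 hc
    cases hq.symm.trans ho
    exact ⟨_, ⟨j, rfl, hj, rfl⟩, RTM.inevitably_ltsFrom (memoryHost_inevitably_entry j hT)⟩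

end Refines

theorem exists_rtm_refines (P : GuardedProgram Act) {D : Type*} (one : D) :
    ∃ U : RTM.{0} Act D, P.lts.Refines U.lts := by
  let f : PointedMap Bool (Option D) := ⟨fun b => cond b (some one) none, rfl⟩
  let g : PointedMap (Option D) Bool := ⟨Option.isSome, rfl⟩
  obtain ⟨M⟩ := P.nonempty_memoryMachine f g (by rintro (_ | _) <;> rfl)
  obtain ⟨q, w, hq, hw⟩ := M.exists_init P.init
  exact ⟨_, (refines_memoryHost hq hw).trans RTM.refines_boot⟩

end GuardedProgram

/-! ### The universal program -/

/-- Codes of transitions, as they occur in Gödel numbers: the source, the symbol read, the action,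
the symbol written, the direction and the target. -/
abbrev TransCode : Type := ℕ × ℕ × ℕ × ℕ × ℕ × ℕ

namespace TransCode

abbrev source (k : TransCode) : ℕ := k.1
abbrev read (k : TransCode) : ℕ := k.2.1
abbrev action (k : TransCode) : ℕ := k.2.2.1
abbrev written (k : TransCode) : ℕ := k.2.2.2.1
abbrev dir (k : TransCode) : ℕ := k.2.2.2.2.1
abbrev target (k : TransCode) : ℕ := k.2.2.2.2.2

end TransCode

/-- A coded configuration of a coded machine: the final states and the transitions of the machine,
followed by the current state, the tape to the left of the head in reverse, and the tape from the
head to the right. -/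
abbrev SimState : Type := (List ℕ × List TransCode) × ℕ × List ℕ × List ℕ

namespace SimState

abbrev finals (σ : SimState) : List ℕ := σ.1.1
abbrev transitions (σ : SimState) : List TransCode := σ.1.2
abbrev state (σ : SimState) : ℕ := σ.2.1
abbrev left (σ : SimState) : List ℕ := σ.2.2.1
abbrev right (σ : SimState) : List ℕ := σ.2.2.2

/-- The union of the singletons of the elements of a list. It is `List.dedup`, but for the order of
the elements, in a form that is easily seen to be primitive recursive. -/
def distinct {α : Type*} [DecidableEq α] (l : List α) : List α := l.foldr List.insert []

theorem mem_distinct {α : Type*} [DecidableEq α] {l : List α} {x : α} :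
    x ∈ distinct l ↔ x ∈ l := by
  induction l with
  | nil => rfl
  | cons a l ih =>
    rw [distinct, List.foldr_cons, List.mem_insert_iff, List.mem_cons]
    exact or_congr Iff.rfl ih

theorem nodup_distinct {α : Type*} [DecidableEq α] (l : List α) : (distinct l).Nodup := by
  induction l with
  | nil => exact List.nodup_nil
  | cons a l ih => exact ih.insert

/-- The first symbol of a coded half-tape, where `b` is the code of the blank. -/
def headOr (b : ℕ) (l : List ℕ) : ℕ := l.head?.getD b

/-- The transitions that are enabled, without repetitions. -/
def enabled (b : ℕ) (σ : SimState) : List TransCode :=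
  distinct (σ.transitions.filter fun k => k.source = σ.state ∧ k.read = headOr b σ.right)

/-- The effect of a transition. -/
def apply (b : ℕ) (σ : SimState) (k : TransCode) : SimState :=
  (σ.1, k.target,
    if k.dir = 0 then (σ.left.tail, headOr b σ.left :: k.written :: σ.right.tail)
    else (k.written :: σ.left, σ.right.tail))

/-- The effect of the `i`-th enabled transition. -/
def next (b i : ℕ) (σ : SimState) : SimState :=
  ((enabled b σ)[i]?.map (apply b σ)).getD σ

/-- The initial configuration of the machine with Gödel number `g`. -/
def load (g : ℕ) : SimState :=
  ((Encodable.decode g : Option (ℕ × ℕ × List ℕ × List TransCode)).map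
    fun p => ((p.2.2.1, p.2.2.2), p.2.1, [], [])).getD (([], []), 0, [], [])

section Primrec

open Primrec

theorem primrec_mem {α : Type*} [Primcodable α] :
    PrimrecRel fun (a : α) (l : List α) => a ∈ l := by
  classical
  refine (PrimrecRel.exists_mem_list (R := fun a b : α => a = b) Primrec.eq).comp₂ .right .left
    |>.of_eq ?_
  simp

theorem primrec_distinct {α : Type*} [Primcodable α] [DecidableEq α] :
    Primrec (distinct : List α → List α) := by
  refine Primrec.list_foldr .id (.const []) (h := fun _ p => List.insert p.1 p.2) ?_
  refine (Primrec.ite (primrec_mem.comp (fst.comp snd) (snd.comp snd)) (snd.comp snd)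
    (list_cons.comp (fst.comp snd) (snd.comp snd))).of_eq ?_
  rintro ⟨_, a, l⟩
  simp [List.insert]

theorem primrec_headOr (b : ℕ) : Primrec (headOr b) :=
  option_getD.comp list_head? (.const b)

theorem primrec_enabled (b : ℕ) : Primrec (enabled b) := by
  have h : PrimrecRel fun (k : TransCode) (p : ℕ × ℕ) => k.source = p.1 ∧ k.read = p.2 :=
    PrimrecPred.and (Primrec.eq.comp (fst.comp fst) (fst.comp snd))
      (Primrec.eq.comp (fst.comp (snd.comp fst)) (snd.comp snd))
  exact primrec_distinct.comp ((PrimrecRel.listFilter h).comp (snd.comp fst)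
    (Primrec.pair (fst.comp snd) ((primrec_headOr b).comp (snd.comp (snd.comp snd)))))

theorem primrec_apply (b : ℕ) : Primrec₂ (apply b) := by
  have hk : Primrec fun p : SimState × TransCode => p.2.2.2.2 :=
    snd.comp (snd.comp (snd.comp snd))
  have written := fst.comp hk
  have dir := fst.comp (snd.comp hk)
  have target := snd.comp (snd.comp hk)
  have machine : Primrec fun p : SimState × TransCode => p.1.1 := fst.comp fst
  have tape : Primrec fun p : SimState × TransCode => p.1.2.2 := snd.comp (snd.comp fst)
  have leftTape := fst.comp tape
  have rightTape := snd.comp tape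
  exact Primrec.pair machine <| Primrec.pair target <|
    Primrec.ite (Primrec.eq.comp dir (.const 0))
      (Primrec.pair (list_tail.comp leftTape) (list_cons.comp ((primrec_headOr b).comp leftTape)
        (list_cons.comp written (list_tail.comp rightTape))))
      (Primrec.pair (list_cons.comp written leftTape) (list_tail.comp rightTape))

theorem primrec_next (b i : ℕ) : Primrec (next b i) :=
  option_getD.comp (option_map (list_getElem?.comp (primrec_enabled b) (.const i))
    (primrec_apply b)) .id

theorem primrec_load : Primrec load := by
  refine option_getD.comp (option_map Primrec.decode ?_) (.const _)
  have machine := snd.comp (snd.comp (Primrec.snd (α := ℕ) (β := ℕ × ℕ × List ℕ × List TransCode)))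
  exact Primrec.pair machine (Primrec.pair (fst.comp (snd.comp snd)) (.const _))

end Primrec

end SimState

instance {Chan D A : Type*} [Finite Chan] [Finite D] [Finite A] : Finite (Action Chan D A) := by
  let f : (Chan × Option D) ⊕ (Chan × Option D) ⊕ A → Action Chan D A :=
    Sum.elim (fun p => .send p.1 p.2) (Sum.elim (fun p => .recv p.1 p.2) .other)
  refine Finite.of_surjective f ?_
  rintro (⟨c, d⟩ | ⟨c, d⟩ | a)
  exacts [⟨.inl (c, d), rfl⟩, ⟨.inr (.inl (c, d)), rfl⟩, ⟨.inr (.inr a), rfl⟩]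

section Program

theorem computable_sumElim {α β γ : Type*} [Primcodable α] [Primcodable β] [Primcodable γ]
    {f : α → γ} {g : β → γ} (hf : Computable f) (hg : Computable g) :
    Computable (Sum.elim f g) := by
  have hf' : Computable₂ fun (_ : α ⊕ β) a => f a := hf.comp .snd
  have hg' : Computable₂ fun (_ : α ⊕ β) b => g b := hg.comp .snd
  exact (Computable.sumCasesOn .id hf' hg').of_eq (by rintro (_ | _) <;> rfl)

open SimState

variable {Chan D A : Type*}

open Classical in
/-- The reaction of the universal program to a symbol when it has received `n` times the symbol
`one`: the symbol `rb` completes the message, and any other symbol is ignored. -/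
noncomputable def receive (one rb : D) (d : Option D) (n : ℕ) : ℕ ⊕ SimState :=
  if d = some one then .inl (n + 1) else if d = some rb then .inr (load (n - 1)) else .inl n

theorem computable_receive (one rb : D) (d : Option D) : Computable (receive one rb d) := by
  unfold receive
  split_ifs
  · exact (Primrec.sumInl.comp Primrec.succ).to_comp
  · exact (Primrec.sumInr.comp (primrec_load.comp Primrec.pred)).to_comp
  · exact Primrec.sumInl.to_comp

/-- The universal program counts the symbols `one` that it receives along the channel `u`, until it
receives `rb`; then it simulates the machine whose Gödel number it has counted. The command
`Sum.inl d` receives `d`, and the command `Sum.inr (a, i)` performs the `i`-th enabled transition of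
the simulated machine if it is labelled `a`. The natural number `b` is the code of the blank. -/
noncomputable def universalProgram [Finite Chan] [Finite D] [Finite A] (u : Chan) (one rb : D)
    (cA : Option (Action Chan D A) → ℕ) (b B : ℕ) : GuardedProgram (Action Chan D A) where
  State := ℕ ⊕ SimState
  Command := Option D ⊕ (Option (Action Chan D A) × Fin B)
  label := Sum.elim (fun d => some (.recv u d)) Prod.fst
  guard := Sum.elim (fun _ => Sum.elim (fun _ => true) fun _ => false) fun j =>
    Sum.elim (fun _ => false) fun σ => (enabled b σ)[j.2]?.map TransCode.action = some (cA j.1)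
  update := Sum.elim (fun d => Sum.elim (receive one rb d) .inr) fun j =>
    Sum.elim .inl fun σ => .inr (next b j.2 σ)
  init := .inl 0
  final := Sum.elim (fun _ => false) fun σ => σ.state ∈ σ.finals
  computable_guard j := by
    rcases j with _ | ⟨a, i⟩
    · exact computable_sumElim (.const _) (.const _)
    · have offered : Primrec fun σ => (enabled b σ)[(i : ℕ)]?.map TransCode.action :=
        Primrec.option_map (Primrec.list_getElem?.comp (primrec_enabled b) (.const (i : ℕ)))
          (Primrec.fst.comp (Primrec.snd.comp (Primrec.snd.comp .snd)))
      exact computable_sumElim (.const _)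
        (PrimrecPred.decide (Primrec.eq.comp offered (.const _))).to_comp
  computable_update j := by
    rcases j with d | ⟨a, i⟩
    · exact computable_sumElim (computable_receive one rb d) Primrec.sumInr.to_comp
    · exact computable_sumElim Primrec.sumInl.to_comp
        (Primrec.sumInr.comp (primrec_next b i)).to_comp
  computable_final := by
    have hfinal : PrimrecPred fun σ : SimState => σ.state ∈ σ.finals :=
      primrec_mem.comp (Primrec.fst.comp .snd) (Primrec.fst.comp .fst)
    exact computable_sumElim (.const _) hfinal.decide.to_comp

variable [Finite Chan] [Finite D] [Finite A] {u : Chan} {one rb : D}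
  {cA : Option (Action Chan D A) → ℕ} {b B : ℕ} {a : Option (Action Chan D A)}
  {s : (universalProgram u one rb cA b B).lts.State}

theorem universalProgram_step_inl_iff {n : ℕ} :
    (universalProgram u one rb cA b B).lts.step (.inl n) a s ↔
      ∃ d, a = some (.recv u d) ∧ s = receive one rb d n := by
  constructor
  · rintro ⟨d | j, rfl, hg, rfl⟩
    · exact ⟨d, rfl, rfl⟩
    · cases hg
  · rintro ⟨d, rfl, rfl⟩
    exact ⟨.inl d, rfl, rfl, rfl⟩

theorem universalProgram_step_inr_iff {σ : SimState} (hσ : (enabled b σ).length ≤ B) :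
    (universalProgram u one rb cA b B).lts.step (.inr σ) a s ↔
      ∃ k ∈ enabled b σ, k.action = cA a ∧ s = .inr (apply b σ k) := by
  have hnext {i : ℕ} {k : TransCode} (hk : (enabled b σ)[i]? = some k) :
      next b i σ = apply b σ k := by
    rw [next, hk]
    rfl
  constructor
  · rintro ⟨d | ⟨a, i⟩, rfl, hg, rfl⟩
    · cases hg
    · obtain ⟨k, hk, hka⟩ := Option.map_eq_some_iff.1 (of_decide_eq_true hg)
      exact ⟨k, List.mem_of_getElem? hk, hka, congrArg Sum.inr (hnext hk)⟩
  · rintro ⟨k, hk, hka, rfl⟩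
    obtain ⟨i, hi, rfl⟩ := List.mem_iff_getElem.1 hk
    have hk := List.getElem?_eq_getElem hi
    exact ⟨.inr (a, ⟨i, hi.trans_le hσ⟩), rfl,
      decide_eq_true (Option.map_eq_some_iff.2 ⟨_, hk, hka⟩), congrArg Sum.inr (hnext hk).symm⟩

end Program

open LTS

/-! ### Receiving the message -/

section Sender

variable {Chan D A : Type*} {u : Chan} {w : List (Option D)}

/-- The configuration of the sender after `i` symbols have been sent. -/
def senderCfg (A : Type*) (u : Chan) (w : List (Option D)) (i : Fin (w.length + 1)) :
    (RTM.sender A u w).lts.State :=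
  (i, Tape.mk₁ [])

theorem isCommunication_of_sender_step (c : (RTM.sender A u w).lts.State)
    (a : Option (Action Chan D A)) (c' : (RTM.sender A u w).lts.State)
    (h : (RTM.sender A u w).lts.step c a c') : IsCommunication {u} a := by
  obtain ⟨_, _, ⟨i, -, -, rfl, -⟩, -⟩ := h
  exact ⟨u, rfl, w.get i, .inl rfl⟩

theorem write_default_move_right_mk₁_nil {Γ : Type*} [Inhabited Γ] :
    ((Tape.mk₁ ([] : List Γ)).write default).move .right = Tape.mk₁ [] := by
  change (Tape.mk₁ ([] : List Γ)).move .right = _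
  exact congrArg (Tape.mk default · (ListBlank.mk [])) cons_default_nil

theorem sender_step_castSucc_iff {i : Fin w.length} {a : Option (Action Chan D A)}
    {c : (RTM.sender A u w).lts.State} :
    (RTM.sender A u w).lts.step (senderCfg A u w i.castSucc) a c ↔
      a = some (.send u (w.get i)) ∧ c = senderCfg A u w i.succ := by
  obtain ⟨t, T⟩ := c
  constructor
  · rintro ⟨_, _, ⟨j, hj, -, ha, rfl, rfl, ht⟩, hT⟩
    obtain rfl := Fin.castSucc_injective _ hj
    exact ⟨ha, Prod.ext ht (hT.trans write_default_move_right_mk₁_nil)⟩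
  · rintro ⟨rfl, hc⟩
    obtain ⟨rfl, rfl⟩ := Prod.mk.inj hc
    exact ⟨none, .right, ⟨i, rfl, rfl, rfl, rfl, rfl, rfl⟩,
      write_default_move_right_mk₁_nil.symm⟩

theorem not_sender_step_last {a : Option (Action Chan D A)}
    {c : (RTM.sender A u w).lts.State} :
    ¬ (RTM.sender A u w).lts.step (senderCfg A u w (Fin.last _)) a c := by
  rintro ⟨_, _, ⟨i, hi, -⟩, -⟩
  exact (Fin.castSucc_lt_last i).ne' hi

theorem inevitably_par_sender {T : LTS (Action Chan D A)} {s : T.State} {r : Option D → T.State}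
    (hs : ∀ {a t}, T.step s a t ↔ ∃ d, a = some (.recv u d) ∧ t = r d) (i : Fin w.length)
    {P : T.State × (RTM.sender A u w).lts.State → Prop}
    (h : (par {u} T (RTM.sender A u w).lts).Inevitably P (r (w.get i), senderCfg A u w i.succ)) :
    (par {u} T (RTM.sender A u w).lts).Inevitably P (s, senderCfg A u w i.castSucc) := by
  refine .of_unique_step ?_ ?_ ?_ h
  · rintro ⟨-, hi⟩
    exact (Fin.castSucc_lt_last i).ne hi
  · exact (par_step_iff isCommunication_of_sender_step).2 (.inr ⟨rfl, _, _,
      ⟨u, rfl, w.get i, .inr ⟨rfl, rfl⟩⟩, hs.2 ⟨_, rfl, rfl⟩,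
      sender_step_castSucc_iff.2 ⟨rfl, rfl⟩⟩)
  · rintro a ⟨t, y⟩ hq
    obtain ⟨hu, ht, -⟩ | ⟨rfl, b, b', hb, ht, hy⟩ :=
      (par_step_iff isCommunication_of_sender_step).1 hq
    · obtain ⟨d, rfl, -⟩ := hs.1 ht
      exact absurd ⟨u, rfl, d, .inr rfl⟩ hu
    · obtain ⟨d, rfl, rfl⟩ := hs.1 ht
      obtain ⟨rfl, rfl⟩ := sender_step_castSucc_iff.1 hy
      obtain ⟨_, _, _, ⟨h, -⟩ | ⟨h, h'⟩⟩ := hb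
      · cases h
      · cases h
        cases h'
        exact ⟨rfl, rfl⟩

end Sender

section Message

variable {D : Type*} {one lb rb : D} {g : ℕ}

theorem length_message : (RTM.message one lb rb g).length = g + 3 := by
  simp [RTM.message]

theorem get_message_zero : (RTM.message one lb rb g).get ⟨0, by simp [length_message]⟩ = some lb :=
  rfl

theorem get_message_succ {n : ℕ} (hn : n < g + 1) :
    (RTM.message one lb rb g).get ⟨n + 1, by rw [length_message]; omega⟩ = some one := by
  simp [RTM.message, hn]

theorem get_message_last :
    (RTM.message one lb rb g).get ⟨g + 2, by rw [length_message]; omega⟩ = some rb := by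
  simp [RTM.message]

open SimState

variable {Chan A : Type*} [Finite Chan] [Finite D] [Finite A] {u : Chan}
  {cA : Option (Action Chan D A) → ℕ} {b B : ℕ}

theorem inevitably_load (h₁ : one ≠ lb) (h₂ : one ≠ rb) (h₃ : lb ≠ rb) :
    (par {u} (universalProgram u one rb cA b B).lts
      (RTM.sender A u (RTM.message one lb rb g)).lts).Inevitably
      (· = (.inr (load g), senderCfg A u _ (Fin.last _)))
      (.inl 0, senderCfg A u _ 0) := by
  let S := par {u} (universalProgram u one rb cA b B).lts
    (RTM.sender A u (RTM.message one lb rb g)).lts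
  let P : S.State → Prop := (· = (.inr (load g), senderCfg A u _ (Fin.last _)))
  have counted (n : ℕ) (hn : n ≤ g + 1) :
      S.Inevitably P (.inl n, senderCfg A u _ ⟨n + 1, by rw [length_message]; omega⟩) := by
    induction hn using Nat.decreasingInduction with
    | self =>
      refine inevitably_par_sender universalProgram_step_inl_iff
        ⟨g + 2, by rw [length_message]; omega⟩ (.here ?_)
      rw [get_message_last, receive, if_neg (by simpa using h₂.symm), if_pos rfl]
      refine Prod.ext rfl (congrArg (senderCfg A u _) (Fin.ext ?_))
      simp [length_message]
    | of_succ n hn ih =>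
      refine inevitably_par_sender universalProgram_step_inl_iff
        ⟨n + 1, by rw [length_message]; omega⟩ ?_
      rw [get_message_succ hn, receive, if_pos rfl]
      exact ih
  refine inevitably_par_sender universalProgram_step_inl_iff ⟨0, by rw [length_message]; omega⟩ ?_
  rw [get_message_zero, receive, if_neg (by simpa using h₁.symm), if_neg (by simpa using h₃)]
  exact counted 0 (Nat.zero_le _)

end Message

/-! ### Simulating the coded machine -/

theorem exists_tape_write_move_injective {D : Type*} (one : D) (d : Option D) :
    ∃ T : Tape (Option D), T.head = d ∧
      Function.Injective fun p : Option D × Dir => (T.write p.1).move p.2 := by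
  let T : Tape (Option D) := Tape.mk' (ListBlank.mk []) (ListBlank.mk [d, none, none, some one])
  refine ⟨T, rfl, ?_⟩
  rintro ⟨e, m⟩ ⟨e', m'⟩ h
  have hnth (i : ℤ) : ((T.write e).move m).nth i = ((T.write e').move m').nth i :=
    congrArg (Tape.nth · i) h
  have hhead (e : Option D) : (T.write e).head = e := rfl
  have h1 : T.nth 1 = none := Tape.mk'_nth_nat _ _ 1
  have h3 : T.nth 3 = some one := Tape.mk'_nth_nat _ _ 3
  have h2 := hnth 2
  have hright := hnth (-1)
  have hleft := hnth 1
  clear h hnth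
  cases m <;> cases m' <;> simp_all [Tape.move_left_nth, Tape.move_right_nth, Tape.write_nth]

theorem RTM.encard_trans_le {Act D : Type*} (one : D) {M : RTM Act D} {B : ℕ}
    (h : M.lts.BranchingBoundedBy B) (s : M.State) (d : Option D) :
    {p : Option Act × Option D × Dir × M.State | M.trans s d p.1 p.2.1 p.2.2.1 p.2.2.2}.encard
      ≤ B := by
  obtain ⟨T, rfl, hT⟩ := exists_tape_write_move_injective one d
  refine le_trans (Set.encard_le_encard_of_injOn
    (f := fun p => (p.1, p.2.2.2, (T.write p.2.1).move p.2.2.1)) ?_ ?_) (h (s, T))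
  · rintro ⟨a, e, m, t⟩ hp
    exact ⟨e, m, hp, rfl⟩
  · rintro ⟨a, e, m, t⟩ - ⟨a', e', m', t'⟩ - hp
    obtain ⟨rfl, hp⟩ := Prod.mk.inj hp
    obtain ⟨rfl, hp⟩ := Prod.mk.inj hp
    obtain ⟨rfl, rfl⟩ := Prod.mk.inj (@hT (e, m) (e', m') hp)
    rfl

namespace SimState

variable {Act D : Type*} {cA : Option Act → ℕ} {cD : Option D → ℕ} {M : RTM Act D} {n : ℕ}
  {e : M.State ≃ Fin n} {fs : List ℕ} {ts : List TransCode}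

/-- The lists `fs` and `ts` contain the codes of the final states and of the transitions of `M`,
when the states of `M` are numbered by `e`. -/
structure IsCoding (cA : Option Act → ℕ) (cD : Option D → ℕ) (M : RTM Act D) {n : ℕ}
    (e : M.State ≃ Fin n) (fs : List ℕ) (ts : List TransCode) : Prop where
  mem_finals : ∀ k, k ∈ fs ↔ ∃ s ∈ M.final, k = (e s : ℕ)
  mem_transitions : ∀ k, k ∈ ts ↔ ∃ s d a d' m t, M.trans s d a d' m t ∧
    k = ((e s : ℕ), cD d, cA a, cD d', RTM.dirCode m, (e t : ℕ))

/-- `σ` represents the configuration `c` of the machine that is coded by `fs` and `ts`. -/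
def Represents (cD : Option D → ℕ) (e : M.State ≃ Fin n) (fs : List ℕ) (ts : List TransCode)
    (σ : SimState) (c : M.lts.State) : Prop :=
  ∃ L R : List (Option D), c.2 = Tape.mk' (ListBlank.mk L) (ListBlank.mk R) ∧
    σ = ((fs, ts), (e c.1 : ℕ), L.map cD, R.map cD)

theorem headOr_map (cD : Option D → ℕ) (L : List (Option D)) :
    headOr (cD none) (L.map cD) = cD (ListBlank.mk L).head := by
  cases L <;> rfl

theorem represents_load {g : ℕ} (hg : g = Encodable.encode (n, (e M.init : ℕ), fs, ts)) :
    Represents cD e fs ts (load g) M.lts.init := by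
  refine ⟨[], [], rfl, ?_⟩
  rw [load, hg, Encodable.encodek]
  rfl

variable {σ : SimState} {c : M.lts.State}

theorem Represents.apply (h : Represents cD e fs ts σ c) (x y a : ℕ) (d' : Option D)
    (m : Dir) (t : M.State) : Represents cD e fs ts
      (apply (cD none) σ (x, y, a, cD d', RTM.dirCode m, (e t : ℕ)))
      (t, (c.2.write d').move m) := by
  obtain ⟨L, R, hc, rfl⟩ := h
  have hw : c.2.write d' = Tape.mk' (ListBlank.mk L) (ListBlank.mk (d' :: R.tail)) := by
    rw [hc, ← ListBlank.cons_head_tail (ListBlank.mk R), Tape.write_mk', ListBlank.tail_cons,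
      ListBlank.tail_mk, ListBlank.cons_mk]
  cases m with
  | left =>
    refine ⟨L.tail, (ListBlank.mk L).head :: d' :: R.tail, ?_, ?_⟩
    · dsimp only
      rw [hw, Tape.move_left_mk', ListBlank.tail_mk, ListBlank.cons_mk]
    · simp [SimState.apply, SimState.left, RTM.dirCode, headOr_map, List.map_tail]
  | right =>
    refine ⟨d' :: L, R.tail, ?_, ?_⟩
    · dsimp only
      rw [hw, Tape.move_right_mk', ListBlank.head_mk, ListBlank.tail_mk, ListBlank.cons_mk]
      rfl
    · simp [SimState.apply, RTM.dirCode, List.map_tail]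

namespace IsCoding

theorem state_mem_finals_iff (hM : IsCoding cA cD M e fs ts)
    (h : Represents cD e fs ts σ c) :
    σ.state ∈ σ.finals ↔ c ∈ M.lts.final := by
  obtain ⟨L, R, -, rfl⟩ := h
  refine (hM.mem_finals _).trans ⟨?_, fun hc => ⟨_, hc, rfl⟩⟩
  rintro ⟨s, hs, hcs⟩
  rwa [← e.injective (Fin.ext hcs)] at hs

theorem mem_enabled_iff (hM : IsCoding cA cD M e fs ts) (hcD : Function.Injective cD)
    (h : Represents cD e fs ts σ c) {k : TransCode} :
    k ∈ enabled (cD none) σ ↔ ∃ a d' m t, M.trans c.1 c.2.head a d' m t ∧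
      k = ((e c.1 : ℕ), cD c.2.head, cA a, cD d', RTM.dirCode m, (e t : ℕ)) := by
  obtain ⟨L, R, hc, rfl⟩ := h
  have hd : c.2.head = (ListBlank.mk R).head := by rw [hc, Tape.mk'_head]
  rw [enabled, mem_distinct, List.mem_filter, hM.mem_transitions, headOr_map, ← hd,
    decide_eq_true_eq]
  constructor
  · rintro ⟨⟨s, d, a, d', m, t, ht, rfl⟩, hs, hd⟩
    obtain rfl := e.injective (Fin.ext hs)
    obtain rfl := hcD hd
    exact ⟨a, d', m, t, ht, rfl⟩
  · rintro ⟨a, d', m, t, ht, rfl⟩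
    exact ⟨⟨_, _, a, d', m, t, ht, rfl⟩, rfl, rfl⟩

theorem length_enabled_le (hM : IsCoding cA cD M e fs ts) (one : D) {B : ℕ}
    (hB : M.lts.BranchingBoundedBy B) (hcD : Function.Injective cD)
    (h : Represents cD e fs ts σ c) :
    (enabled (cD none) σ).length ≤ B := by
  have hnodup : (enabled (cD none) σ).Nodup := nodup_distinct _
  rw [← List.toFinset_card_of_nodup hnodup, ← ENat.natCast_le_natCast,
    ← Set.encard_coe_eq_coe_finsetCard]
  let code (p : Option Act × Option D × Dir × M.State) : TransCode :=
    ((e c.1 : ℕ), cD c.2.head, cA p.1, cD p.2.1, RTM.dirCode p.2.2.1, (e p.2.2.2 : ℕ))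
  refine (Set.encard_le_encard ?_).trans
    ((Set.encard_image_le code _).trans (RTM.encard_trans_le one hB c.1 c.2.head))
  intro k hk
  obtain ⟨a, d', m, t, ht, rfl⟩ := (hM.mem_enabled_iff hcD h).1 (List.mem_toFinset.1 hk)
  exact ⟨(a, d', m, t), ht, rfl⟩

theorem exists_mem_enabled (hM : IsCoding cA cD M e fs ts) (hcD : Function.Injective cD)
    (h : Represents cD e fs ts σ c) {a : Option Act} {c' : M.lts.State} (hc : M.lts.step c a c') :
    ∃ k ∈ enabled (cD none) σ, k.action = cA a ∧
      Represents cD e fs ts (SimState.apply (cD none) σ k) c' := by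
  obtain ⟨t, _⟩ := c'
  obtain ⟨d', m, ht, rfl⟩ := hc
  exact ⟨_, (hM.mem_enabled_iff hcD h).2 ⟨a, d', m, t, ht, rfl⟩, rfl, h.apply ..⟩

theorem exists_step (hM : IsCoding cA cD M e fs ts) (hcA : Function.Injective cA)
    (hcD : Function.Injective cD) (h : Represents cD e fs ts σ c) {k : TransCode}
    (hk : k ∈ enabled (cD none) σ) {a : Option Act} (hka : k.action = cA a) :
    ∃ c', M.lts.step c a c' ∧ Represents cD e fs ts (SimState.apply (cD none) σ k) c' := by
  obtain ⟨a', d', m, t, ht, rfl⟩ := (hM.mem_enabled_iff hcD h).1 hk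
  obtain rfl := hcA hka
  exact ⟨_, ⟨d', m, ht, rfl⟩, h.apply ..⟩

end IsCoding

end SimState

section Universal

open SimState

variable {Chan D A : Type*} {u : Chan} {M : RTM (Action Chan D A) D}

theorem RTM.AvoidsChannel.not_isCommunication (hM : M.AvoidsChannel u) {c c' : M.lts.State}
    {a : Option (Action Chan D A)} (h : M.lts.step c a c') : ¬ IsCommunication {u} a := by
  obtain ⟨e, m, ht, -⟩ := h
  rintro ⟨_, rfl, d, rfl | rfl⟩
  · exact (hM _ _ _ _ _ _).1 ht
  · exact (hM _ _ _ _ _ _).2 ht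

variable [Finite Chan] [Finite D] [Finite A] {one lb rb : D}
  {cA : Option (Action Chan D A) → ℕ} {cD : Option D → ℕ} {B g : ℕ}

theorem refines_par_universalProgram (h₁ : one ≠ lb) (h₂ : one ≠ rb) (h₃ : lb ≠ rb)
    (hcA : Function.Injective cA) (hcD : Function.Injective cD) (hM : M.AvoidsChannel u)
    (hB : M.lts.BranchingBoundedBy B) (hg : M.IsGodelNumber cA cD g) :
    M.lts.Refines (par {u} (universalProgram u one rb cA (cD none) B).lts
      (RTM.sender A u (RTM.message one lb rb g)).lts) := by
  obtain ⟨n, e, fs, ts, hfs, hts, hg⟩ := hg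
  have hcode : IsCoding cA cD M e fs ts := ⟨hfs, hts⟩
  refine ⟨fun c p => ∃ σ, p = (.inr σ, senderCfg A u _ (Fin.last _)) ∧ Represents cD e fs ts σ c,
    ?_, ?_, ?_, (inevitably_load h₁ h₂ h₃).mono fun _ hp => ⟨_, hp, represents_load hg⟩⟩
  · rintro c _ ⟨σ, rfl, h⟩
    have hfinal := hcode.state_mem_finals_iff h
    exact ⟨fun hc => ⟨decide_eq_true (hfinal.2 hc), rfl⟩,
      fun hp => hfinal.1 (of_decide_eq_true hp.1)⟩
  · rintro c _ a c' ⟨σ, rfl, h⟩ hc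
    obtain ⟨k, hk, hka, h'⟩ := hcode.exists_mem_enabled hcD h hc
    have hσ := hcode.length_enabled_le one hB hcD h
    exact ⟨(.inr (SimState.apply _ σ k), _), (par_step_iff isCommunication_of_sender_step).2 (.inl
      ⟨hM.not_isCommunication hc, (universalProgram_step_inr_iff hσ).2 ⟨k, hk, hka, rfl⟩, rfl⟩),
      .here ⟨_, rfl, h'⟩⟩
  · rintro c _ a ⟨s, y⟩ ⟨σ, rfl, h⟩ hp
    have hσ := hcode.length_enabled_le one hB hcD h
    obtain ⟨-, hs, rfl⟩ | ⟨-, _, _, -, -, hy⟩ := (par_step_iff isCommunication_of_sender_step).1 hp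
    · obtain ⟨k, hk, hka, rfl⟩ := (universalProgram_step_inr_iff hσ).1 hs
      obtain ⟨c', hc, h'⟩ := hcode.exists_step hcA hcD h hk hka
      exact ⟨c', hc, .here ⟨_, rfl, h'⟩⟩
    · exact absurd hy not_sender_step_last

end Universal

end ReactiveTM

/-- For all finite alphabets, codings of them, and every bound `B`, there is a reactive Turing machine
that is universal up to `B`. -/
theorem mainTheorem4 {Chan D A : Type*}
    [Finite Chan] [Finite D] [Finite A]
    (u : Chan) (one lb rb : D) (h₁ : one ≠ lb) (h₂ : one ≠ rb) (h₃ : lb ≠ rb)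
    (cA : Option (ReactiveTM.Action Chan D A) → ℕ) (hcA : Function.Injective cA)
    (cD : Option D → ℕ) (hcD : Function.Injective cD) (B : ℕ) :
    ∃ U : ReactiveTM.RTM.{0} (ReactiveTM.Action Chan D A) D,
      ReactiveTM.RTM.UniversalUpTo.{w} u one lb rb cA cD B U := by
  obtain ⟨U, hU⟩ := (ReactiveTM.universalProgram u one rb cA (cD none) B).exists_rtm_refines one
  refine ⟨U, fun M hM hB g hg => ReactiveTM.LTS.Refines.divBranchingBisimilar ?_⟩
  exact (ReactiveTM.refines_par_universalProgram h₁ h₂ h₃ hcA hcD hM hB hg).trans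
    (hU.par ReactiveTM.isCommunication_of_sender_step)
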